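/- Let $\delta$ be an analytic Jordan curve, that is, $\delta(t)=\Phi(e^{it})$ for $t\in\mathbb R$, where $\Phi$ is holomorphic and injective on an annulus $\{r<|z|<R\}$ with $0<r<1<R$. Let $\Omega$ be the interior of $\delta$ (the bounded component of the complement of its trace), and let $\varphi:D\to\Omega$ be a Riemann map (a holomorphic bijection) of the open unit disk $D$ onto $\Omega$. Denote by $\varphi(e^{i\theta})$ the boundary values of $\varphi$ (limits from $D$), put $\gamma(\theta)=\varphi(e^{i\theta})$ and $\gamma^*=\{\gamma(\theta):\theta\in\mathbb R\}=\partial\Omega$, and let $A$ and $B$ be the bounded and the unbounded component of $\mathbb C\setminus\gamma^*$. For $k\in\{0,1,2,\dots\}\cup\{\infty\}$ let $C^k(\gamma^*)=C^k(\partial\Omega)$ be the space of continuous functions $u:\gamma^*\to\mathbb C$ for which $\theta\mapsto u(\varphi(e^{i\theta}))$ is $k$ times continuously differentiable (infinitely differentiable if $k=\infty$) on $\mathbb R$, with the topology defined by the seminorms $$\sup_{\theta\in\mathbb R}\left|\frac{d^l}{d\theta^l}\,u(\varphi(e^{i\theta}))\right|,\qquad l\in\{0,1,2,\dots\},\ l\le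 k.$$ For an open set $S\subseteq\mathbb C\setminus\gamma^*$ and $z_0\in\gamma^*$, say that $u$ extends to $S$ near $z_0$ if there are $r>0$ and a continuous function $\lambda:\gamma^*\cup(D(z_0,r)\cap S)\to\mathbb C$ which is holomorphic on $D(z_0,r)\cap S$ and satisfies $\lambda=u$ on $D(z_0,r)\cap\gamma^*$. Here $D(z_0,r)$ is the open disk of centre $z_0$ and radius $r$. Define - $U_2(\gamma^*,k)$: the set of $u\in C^k(\gamma^*)$ that do not extend to $B$ near any $z_0\in\gamma^*$; - $U_3(\gamma^*,k)$: the set of $u\in C^k(\gamma^*)$ that do not extend to $A$ near any $z_0\in\gamma^*$; - $U_4(\gamma^*,k)$: the set of $u\in C^k(\gamma^*)$ that extend neither to $B$ near any $z_0\in\gamma^*$ nor to $A$ near any $z_0\in\gamma^*$. **Theorem 4.27.** For every $k=0,1,2,\dots,\infty$, each of the classes $U_2(\gamma^*,k)$, $U_3(\gamma^*,k)$, $U_4(\gamma^*,k)$ is a dense $G_\delta$ subset of $C^k(\gamma^*)$. -/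

import Mathlib

open Set Metric Filter Topology

namespace JordanCurve

/-- `δ` is an analytic Jordan curve: `δ t = Φ (e^{it})` for a function `Φ` which is holomorphic and
injective on an annulus `r < |z| < R` with `0 < r < 1 < R`. -/
def IsAnalytic (δ : ℝ → ℂ) : Prop :=
  ∃ (r R : ℝ) (Φ : ℂ → ℂ), 0 < r ∧ r < 1 ∧ 1 < R ∧
    DifferentiableOn ℂ Φ {z : ℂ | r < ‖z‖ ∧ ‖z‖ < R} ∧
    InjOn Φ {z : ℂ | r < ‖z‖ ∧ ‖z‖ < R} ∧
    ∀ t : ℝ, δ t = Φ (Complex.exp (t * Complex.I))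

/-- The points off `K` whose connected component in `ℂ \ K` is bounded: for the trace `K` of a
Jordan curve this is the bounded component of the complement (the interior of the curve). -/
def boundedSide (K : Set ℂ) : Set ℂ :=
  {z | z ∈ Kᶜ ∧ Bornology.IsBounded (connectedComponentIn Kᶜ z)}

/-- The points off `K` whose connected component in `ℂ \ K` is unbounded: for the trace `K` of a
Jordan curve this is the unbounded component of the complement (the exterior of the curve). -/
def unboundedSide (K : Set ℂ) : Set ℂ :=
  {z | z ∈ Kᶜ ∧ ¬ Bornology.IsBounded (connectedComponentIn Kᶜ z)}

/-- `φ` is a Riemann map of the open unit disk onto `Ω`: holomorphic and bijective. Only the values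
of `φ` on the open disk matter. -/
def IsRiemannMap (φ : ℂ → ℂ) (Ω : Set ℂ) : Prop :=
  DifferentiableOn ℂ φ (ball 0 1) ∧ BijOn φ (ball 0 1) Ω

/-- The curve `γ θ = φ (e^{iθ})`, where the value of `φ` at a point of the unit circle is its
limit from the open unit disk. -/
noncomputable def boundaryCurve (φ : ℂ → ℂ) (θ : ℝ) : ℂ :=
  extendFrom (ball (0 : ℂ) 1) φ (Complex.exp (θ * Complex.I))

/-- The trace `γ*` of the curve `γ θ = φ (e^{iθ})`. -/
def trace (φ : ℂ → ℂ) : Set ℂ := range (boundaryCurve φ)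

/-- The function `θ ↦ u (φ (e^{iθ}))`, for `u` defined on `γ*`. -/
noncomputable def pullback (φ : ℂ → ℂ) (u : trace φ → ℂ) (θ : ℝ) : ℂ :=
  u ⟨boundaryCurve φ θ, mem_range_self θ⟩

theorem pullback_add (φ : ℂ → ℂ) (u v : trace φ → ℂ) :
    pullback φ (u + v) = pullback φ u + pullback φ v := rfl

theorem pullback_smul (φ : ℂ → ℂ) (c : ℂ) (u : trace φ → ℂ) :
    pullback φ (c • u) = c • pullback φ u := rfl

theorem pullback_periodic (φ : ℂ → ℂ) (u : trace φ → ℂ) :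
    Function.Periodic (pullback φ u) (2 * Real.pi) := by
  intro θ
  have h : boundaryCurve φ (θ + 2 * Real.pi) = boundaryCurve φ θ := by
    unfold boundaryCurve
    congr 1
    push_cast
    rw [add_mul]
    exact Complex.exp_periodic _
  exact congrArg u (Subtype.ext h)

/-- The functions `u : γ* → ℂ` of class `C^k`, `k = 0, 1, …, ∞`, as a vector space: `u` is
continuous and `θ ↦ u (φ (e^{iθ}))` is `k` times continuously differentiable. -/
def ckSubmodule (φ : ℂ → ℂ) (k : ℕ∞) : Submodule ℂ (trace φ → ℂ) where
  carrier := {u | Continuous u ∧ ContDiff ℝ k (pullback φ u)}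
  add_mem' hu hv := ⟨hu.1.add hv.1, hu.2.add hv.2⟩
  zero_mem' := ⟨continuous_const, contDiff_const⟩
  smul_mem' c _ hu := ⟨hu.1.const_smul c, hu.2.const_smul c⟩

/-- The space `C^k(γ*)`. This is a type synonym, so that it does not carry the topology of
pointwise convergence. -/
def Ck (φ : ℂ → ℂ) (k : ℕ∞) : Type := ↥(ckSubmodule φ k)

noncomputable instance (φ : ℂ → ℂ) (k : ℕ∞) : AddCommGroup (Ck φ k) :=
  inferInstanceAs (AddCommGroup ↥(ckSubmodule φ k))

noncomputable instance (φ : ℂ → ℂ) (k : ℕ∞) : Module ℂ (Ck φ k) :=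
  inferInstanceAs (Module ℂ ↥(ckSubmodule φ k))

/-- The function on `γ*` underlying an element of `C^k(γ*)`. -/
def Ck.toFun {φ : ℂ → ℂ} {k : ℕ∞} (u : Ck φ k) : trace φ → ℂ := Subtype.val u

theorem Ck.toFun_add {φ : ℂ → ℂ} {k : ℕ∞} (u v : Ck φ k) :
    (u + v).toFun = u.toFun + v.toFun := rfl

theorem Ck.toFun_smul {φ : ℂ → ℂ} {k : ℕ∞} (c : ℂ) (u : Ck φ k) :
    (c • u).toFun = c • u.toFun := rfl

theorem Ck.contDiff {φ : ℂ → ℂ} {k : ℕ∞} (u : Ck φ k) {l : ℕ} (hl : (l : ℕ∞) ≤ k) :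
    ContDiff ℝ l (pullback φ u.toFun) :=
  (Subtype.prop u).2.of_le (by exact_mod_cast hl)

theorem Ck.bddAbove {φ : ℂ → ℂ} {k : ℕ∞} (u : Ck φ k) {l : ℕ} (hl : (l : ℕ∞) ≤ k) :
    BddAbove (range fun θ : ℝ => ‖iteratedDeriv l (pullback φ u.toFun) θ‖) := by
  have hc : Continuous (iteratedDeriv l (pullback φ u.toFun)) :=
    (u.contDiff hl).continuous_iteratedDeriv l le_rfl
  have hp : Function.Periodic (iteratedDeriv l (pullback φ u.toFun)) (2 * Real.pi) := by
    intro θ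
    have h := congrFun (iteratedDeriv_comp_add_const l (pullback φ u.toFun) (2 * Real.pi)) θ
    rw [← h]
    congr 1
    funext t
    exact pullback_periodic φ u.toFun t
  have hp' : Function.Periodic (fun θ : ℝ => ‖iteratedDeriv l (pullback φ u.toFun) θ‖)
      (2 * Real.pi) := fun θ => by simp only [hp θ]
  exact (hp'.compact_of_continuous (by positivity) hc.norm).bddAbove

/-- The seminorms `sup_θ |d^l/dθ^l u (φ (e^{iθ}))|` of `C^k(γ*)`, for the finite `l ≤ k`. -/
noncomputable def ckSeminorm (φ : ℂ → ℂ) (k : ℕ∞) :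
    SeminormFamily ℂ (Ck φ k) {l : ℕ // (l : ℕ∞) ≤ k} := fun l =>
  Seminorm.of (fun u => ⨆ θ : ℝ, ‖iteratedDeriv l.1 (pullback φ u.toFun) θ‖)
    (by
      intro u v
      refine ciSup_le fun θ => ?_
      rw [Ck.toFun_add, pullback_add, iteratedDeriv_add (u.contDiff l.2).contDiffAt
        (v.contDiff l.2).contDiffAt]
      exact (norm_add_le _ _).trans (add_le_add (le_ciSup (u.bddAbove l.2) θ)
        (le_ciSup (v.bddAbove l.2) θ)))
    (by
      intro c u
      rw [Real.mul_iSup_of_nonneg (norm_nonneg c)]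
      refine iSup_congr fun θ => ?_
      rw [Ck.toFun_smul, pullback_smul, iteratedDeriv_const_smul (u.contDiff l.2).contDiffAt,
        norm_smul])

/-- The topology of `C^k(γ*)` is the one defined by these seminorms. -/
noncomputable instance (φ : ℂ → ℂ) (k : ℕ∞) : TopologicalSpace (Ck φ k) :=
  haveI : Nonempty {l : ℕ // (l : ℕ∞) ≤ k} := ⟨⟨0, by simp⟩⟩
  (ckSeminorm φ k).moduleFilterBasis.topology

/-- `u` extends holomorphically near `z₀` into the side `S` of `K`: for some `r > 0` there is a
function which is continuous on `K ∪ (D(z₀, r) ∩ S)`, holomorphic on `D(z₀, r) ∩ S`, and equal to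
`u` on `D(z₀, r) ∩ K`. -/
def ExtendsAt (K S : Set ℂ) (u : K → ℂ) (z₀ : ℂ) : Prop :=
  ∃ r : ℝ, 0 < r ∧ ∃ F : ℂ → ℂ,
    ContinuousOn F (K ∪ (ball z₀ r ∩ S)) ∧ DifferentiableOn ℂ F (ball z₀ r ∩ S) ∧
    ∀ z : K, (z : ℂ) ∈ ball z₀ r → F z = u z

/-- The class of `u ∈ C^k(γ*)` that do not extend into the unbounded component of `ℂ \ γ*`
near any point of `γ*`. -/
def U₂ (φ : ℂ → ℂ) (k : ℕ∞) : Set (Ck φ k) :=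
  {u | ¬ ∃ z₀ ∈ trace φ, ExtendsAt (trace φ) (unboundedSide (trace φ)) u.toFun z₀}

/-- The class of `u ∈ C^k(γ*)` that do not extend into the bounded component of `ℂ \ γ*`
near any point of `γ*`. -/
def U₃ (φ : ℂ → ℂ) (k : ℕ∞) : Set (Ck φ k) :=
  {u | ¬ ∃ z₀ ∈ trace φ, ExtendsAt (trace φ) (boundedSide (trace φ)) u.toFun z₀}

/-- The class of `u ∈ C^k(γ*)` that extend neither into the unbounded nor into the bounded
component of `ℂ \ γ*` near any point of `γ*`. -/
def U₄ (φ : ℂ → ℂ) (k : ℕ∞) : Set (Ck φ k) :=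
  {u | (¬ ∃ z₀ ∈ trace φ, ExtendsAt (trace φ) (unboundedSide (trace φ)) u.toFun z₀) ∧
    ¬ ∃ z₀ ∈ trace φ, ExtendsAt (trace φ) (boundedSide (trace φ)) u.toFun z₀}

end JordanCurve

namespace JordanCurve

/-! ### Injective holomorphic maps -/

/-! Near a point of the curve, `w ↦ Ψ (exp (i w))`, with `Ψ` a conformal collar of the curve,
flattens the curve to the real line and the chosen side to the upper half plane. Extendability
becomes a question about half discs. Every extendable function lies in one of countably many
classes: rational centre, radius `1 / (n + 1)`, extension bounded by an integer `M`.

The key is a two-constants estimate (`two_constants_half`): a bounded holomorphic function on a half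
disc that is small on the diameter is small on a smaller half disc. Hence a uniform limit of members
of one class still extends, to a smaller half disc (`halfDiscExt_of_forall_approx`). So the closure
of each class contains only extendable functions, and the non-extendable ones form the countable
intersection of the complements of these closures, a `G_δ`.

For density, one non-extendable `w` suffices. If `u + c w` and `u + d w` lay in the same class with
`c ≠ d`, then `w` would extend; so all but countably many real `c` make `u + c w` non-extendable.
Baire's theorem is applied not in `C^k` but in the space of bounded sequences, to find `w` as a
series of bump functions (`exists_tsum_notMem`); a single bump fails to extend by boundary
uniqueness (`HalfDiscExt.eq_zero`).

Smoothness is measured along the Riemann map, extension along the collar. All that has to link them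
is that the boundary values of `φ` give a homeomorphism of the circle onto the curve. This comes
from a Schwarz–Pick and maximum principle argument applied to `Ψ⁻¹ ∘ φ` and to `φ⁻¹ ∘ Ψ`. -/

theorem map_nhds_eq_of_injOn {f : ℂ → ℂ} {U : Set ℂ} (hU : IsOpen U)
    (hf : DifferentiableOn ℂ f U) (hi : InjOn f U) {z : ℂ} (hz : z ∈ U) :
    𝓝 (f z) ≤ map f (𝓝 z) := by
  have ha : AnalyticAt ℂ f z := hf.analyticAt (hU.mem_nhds hz)
  refine ha.eventually_constant_or_nhds_le_map_nhds.resolve_left fun hc => ?_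
  have h1 : ∀ᶠ w in 𝓝 z, w ∈ ({z} : Set ℂ) := by
    filter_upwards [hc, hU.mem_nhds hz] with w hw hwU
    exact hi hwU hz hw
  have h2 : ({z} : Set ℂ) ∈ 𝓝 z := h1
  exact not_isOpen_singleton z (isOpen_singleton_iff_nhds_eq_pure z |>.2
    (le_antisymm (by simpa using h2) (pure_le_nhds z)))

theorem isOpen_image_of_injOn {f : ℂ → ℂ} {U : Set ℂ} (hU : IsOpen U)
    (hf : DifferentiableOn ℂ f U) (hi : InjOn f U) {V : Set ℂ} (hV : IsOpen V) (hVU : V ⊆ U) :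
    IsOpen (f '' V) := by
  rw [isOpen_iff_mem_nhds]
  rintro _ ⟨z, hz, rfl⟩
  exact map_nhds_eq_of_injOn hU hf hi (hVU hz) (image_mem_map (hV.mem_nhds hz))

theorem invFunOn_image_continuousAt {f : ℂ → ℂ} {U : Set ℂ} (hU : IsOpen U)
    (hf : DifferentiableOn ℂ f U) (hi : InjOn f U) {z : ℂ} (hz : z ∈ U) :
    ContinuousAt (Function.invFunOn f U) (f z) := by
  have hl : Function.invFunOn f U (f z) = z := hi.leftInvOn_invFunOn hz
  rw [ContinuousAt, hl]
  intro V hV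
  have h := map_nhds_eq_of_injOn hU hf hi hz (image_mem_map (inter_mem hV (hU.mem_nhds hz)))
  rw [mem_map]
  refine mem_of_superset h ?_
  rintro _ ⟨w, ⟨hwV, hwU⟩, rfl⟩
  rw [mem_preimage, hi.leftInvOn_invFunOn hwU]
  exact hwV

/-- Nonvanishing of the derivative is not needed: critical points are isolated, the inverse is
continuous at their images, and those images are removable singularities of the inverse. -/
theorem differentiableOn_invFunOn {f : ℂ → ℂ} {U : Set ℂ} (hU : IsOpen U)
    (hf : DifferentiableOn ℂ f U) (hi : InjOn f U) :
    DifferentiableOn ℂ (Function.invFunOn f U) (f '' U) := by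
  set g := Function.invFunOn f U with hg
  have hgl : ∀ {z}, z ∈ U → g (f z) = z := fun hz => hi.leftInvOn_invFunOn hz
  have hreg : ∀ z ∈ U, deriv f z ≠ 0 → DifferentiableAt ℂ g (f z) := by
    intro z hz hd
    have h1 : HasDerivAt f (deriv f z) (g (f z)) := by
      rw [hgl hz]; exact (hf.differentiableAt (hU.mem_nhds hz)).hasDerivAt
    refine (h1.of_local_left_inverse (invFunOn_image_continuousAt hU hf hi hz) hd ?_).differentiableAt
    have h := map_nhds_eq_of_injOn hU hf hi hz (image_mem_map (hU.mem_nhds hz))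
    filter_upwards [h]
    rintro _ ⟨w, hw, rfl⟩
    exact congrArg f (hgl hw)
  rintro _ ⟨z, hz, rfl⟩
  have ha : AnalyticAt ℂ f z := hf.analyticAt (hU.mem_nhds hz)
  have hiso : ∀ᶠ w in 𝓝[≠] z, deriv f w ≠ 0 := by
    refine ha.deriv.eventually_eq_zero_or_eventually_ne_zero.resolve_left fun h0 => ?_
    obtain ⟨ε, hε, hb⟩ := Metric.eventually_nhds_iff_ball.1 (h0.and (hU.mem_nhds hz))
    have hconst : ∀ w ∈ ball z ε, f w = f z := fun w hw =>
      (isOpen_ball).is_const_of_deriv_eq_zero (convex_ball z ε).isPreconnected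
        (fun x hx => (hf.differentiableAt (hU.mem_nhds (hb x hx).2)).differentiableWithinAt)
        (fun x hx => (hb x hx).1) hw (mem_ball_self hε)
    have hw : z + (ε / 2 : ℝ) ∈ ball z ε := by
      rw [mem_ball, dist_eq_norm, add_sub_cancel_left, Complex.norm_real, Real.norm_eq_abs,
        abs_of_pos (by positivity)]
      linarith
    have := hi (hb _ hw).2 hz (hconst _ hw)
    rw [add_eq_left, Complex.ofReal_eq_zero] at this
    linarith
  have hcont := invFunOn_image_continuousAt hU hf hi hz
  refine (Complex.analyticAt_of_differentiable_on_punctured_nhds_of_continuousAt ?_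
    hcont).differentiableAt.differentiableWithinAt
  rw [eventually_nhdsWithin_iff] at hiso ⊢
  have h := map_nhds_eq_of_injOn hU hf hi hz
    (image_mem_map (inter_mem hiso (hU.mem_nhds hz)))
  filter_upwards [h]
  rintro _ ⟨w, ⟨hw, hwU⟩, rfl⟩ hne
  exact hreg w hwU (hw fun h => hne (by rw [h]; rfl))

/-! ### A two-constants estimate on half discs -/

/-- The part of the disc of centre `t` and radius `a` in the closed upper half plane. -/
def closedHalf (t a : ℝ) : Set ℂ := {w | w ∈ ball (t : ℂ) a ∧ 0 ≤ w.im}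

/-- The part of the disc of centre `t` and radius `a` in the open upper half plane. -/
def openHalf (t a : ℝ) : Set ℂ := {w | w ∈ ball (t : ℂ) a ∧ 0 < w.im}

theorem isOpen_openHalf (t a : ℝ) : IsOpen (openHalf t a) :=
  isOpen_ball.inter (isOpen_lt continuous_const Complex.continuous_im)

theorem openHalf_subset (t a : ℝ) : openHalf t a ⊆ closedHalf t a := fun _ h => ⟨h.1, h.2.le⟩

theorem ball_real_mono {t a s b : ℝ} (h : |s - t| + b ≤ a) :
    ball (s : ℂ) b ⊆ ball (t : ℂ) a := by
  apply ball_subset_ball'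
  rw [dist_eq_norm, ← Complex.ofReal_sub, Complex.norm_real, Real.norm_eq_abs]
  linarith

theorem closedHalf_mono {t a s b : ℝ} (h : |s - t| + b ≤ a) : closedHalf s b ⊆ closedHalf t a :=
  fun _ hw => ⟨ball_real_mono h hw.1, hw.2⟩

theorem openHalf_mono {t a s b : ℝ} (h : |s - t| + b ≤ a) : openHalf s b ⊆ openHalf t a :=
  fun _ hw => ⟨ball_real_mono h hw.1, hw.2⟩

theorem convex_openHalf (t a : ℝ) : Convex ℝ (openHalf t a) :=
  (convex_ball _ _).inter (convex_halfSpace_im_gt 0)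

theorem closedHalf_subset_closure (t a : ℝ) : closedHalf t a ⊆ closure (openHalf t a) := by
  rintro w ⟨hw, him⟩
  have h1 : Tendsto (fun s : ℝ => w + s * Complex.I) (𝓝[>] 0) (𝓝 w) := by
    have : Continuous fun s : ℝ => w + s * Complex.I := by fun_prop
    have h := this.tendsto 0
    simp only [Complex.ofReal_zero, zero_mul, add_zero] at h
    exact h.mono_left nhdsWithin_le_nhds
  refine mem_closure_of_tendsto h1 ?_
  filter_upwards [h1.eventually (isOpen_ball.mem_nhds hw), self_mem_nhdsWithin] with s hs hs0
  refine ⟨hs, ?_⟩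
  have : (0 : ℝ) < s := hs0
  simp
  linarith

/-- Maximum principle for `G exp (N h)`, where `h = 2iζ - ζ²` and `ζ = (w - t) / b`. The real part
of `h` is at most `0` on the diameter, at most `-1` on the arc, and at least `-1/2` on the half disc
of radius `b / 5`. Taking `N` large and then `ε` small makes the bound as small as desired. -/
theorem two_constants_half {G : ℂ → ℂ} {t b ε M N : ℝ} (hb : 0 < b)
    (hc : ContinuousOn G {w | w ∈ closedBall (t : ℂ) b ∧ 0 ≤ w.im})
    (hd : DifferentiableOn ℂ G (openHalf t b)) (hN : 0 ≤ N)
    (hε : ∀ x : ℝ, |x - t| ≤ b → ‖G x‖ ≤ ε)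
    (hM : ∀ w, w ∈ closedBall (t : ℂ) b → 0 ≤ w.im → ‖G w‖ ≤ M)
    {w : ℂ} (hw : w ∈ closedHalf t (b / 5)) :
    ‖G w‖ ≤ Real.exp (N / 2) * max ε (M * Real.exp (-N)) := by
  set h : ℂ → ℂ := fun w => 2 * Complex.I * ((w - t) / b) - ((w - t) / b) ^ 2 with hh
  have hhd : Differentiable ℂ h := by
    simp only [hh]; fun_prop
  have hre : ∀ w : ℂ, (h w).re = -2 * (w.im / b) - ((w.re - t) / b) ^ 2 + (w.im / b) ^ 2 := by
    intro w
    simp [hh, pow_two, Complex.mul_re, Complex.div_ofReal_re, Complex.div_ofReal_im]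
    ring
  set E : ℂ → ℂ := fun w => G w * Complex.exp (N * h w) with hE
  have hEn : ∀ w, ‖E w‖ = ‖G w‖ * Real.exp (N * (h w).re) := by
    intro w
    simp only [hE, norm_mul, Complex.norm_exp]
    simp
  set C := {w : ℂ | w ∈ closedBall (t : ℂ) b ∧ 0 ≤ w.im} with hC
  have hCc : IsClosed C := isClosed_closedBall.inter
    (isClosed_le continuous_const Complex.continuous_im)
  have hsub : openHalf t b ⊆ C := fun w hw => ⟨ball_subset_closedBall hw.1, hw.2.le⟩
  have hcl : closure (openHalf t b) ⊆ C := closure_minimal hsub hCc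
  have hbound : ∀ z ∈ frontier (openHalf t b), ‖E z‖ ≤ max ε (M * Real.exp (-N)) := by
    intro z hz
    rw [(isOpen_openHalf t b).frontier_eq] at hz
    have hzC := hcl hz.1
    have hM0 : 0 ≤ M := (norm_nonneg _).trans (hM z hzC.1 hzC.2)
    have hn : ‖z - t‖ ^ 2 = (z.re - t) ^ 2 + z.im ^ 2 := by
      rw [Complex.sq_norm, Complex.normSq_apply]; simp; ring
    have hle : ‖z - t‖ ≤ b := by simpa [dist_eq_norm] using hzC.1
    rw [hEn]
    by_cases him : z.im = 0
    · have hzr : z = (z.re : ℂ) := by apply Complex.ext <;> simp [him]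
      have h1 : ‖G z‖ ≤ ε := by
        rw [hzr]
        apply hε
        have : |z.re - t| = ‖z - t‖ := by
          rw [hzr]; rw [← Complex.ofReal_sub, Complex.norm_real]; simp
        linarith
      refine le_trans ?_ (le_max_left _ _)
      have h2 : Real.exp (N * (h z).re) ≤ 1 := by
        rw [Real.exp_le_one_iff, hre, him]
        have := sq_nonneg ((z.re - t) / b)
        have h3 : -2 * (0 / b) - ((z.re - t) / b) ^ 2 + (0 / b) ^ 2 ≤ 0 := by
          simp; positivity
        exact mul_nonpos_of_nonneg_of_nonpos hN h3
      calc _ ≤ ε * 1 := by gcongr; exact (norm_nonneg _).trans h1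
        _ = ε := mul_one _
    · have hpos : 0 < z.im := lt_of_le_of_ne hzC.2 (Ne.symm him)
      have heq : ‖z - t‖ = b := by
        by_contra hne
        exact hz.2 ⟨by rw [mem_ball, dist_eq_norm]; exact lt_of_le_of_ne hle hne, hpos⟩
      refine le_trans ?_ (le_max_right _ _)
      have h2 : (h z).re ≤ -1 := by
        rw [hre]
        set y := z.im / b with hy
        have hy0 : 0 ≤ y := by positivity
        have hsq : ((z.re - t) / b) ^ 2 = 1 - y ^ 2 := by
          rw [hy, div_pow, div_pow, eq_sub_iff_add_eq, ← add_div, ← hn, heq, div_self]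
          positivity
        have hy1 : y ≤ 1 := by
          have := sq_nonneg ((z.re - t) / b)
          nlinarith
        rw [hsq]
        nlinarith
      have h3 : Real.exp (N * (h z).re) ≤ Real.exp (-N) := by
        apply Real.exp_le_exp.2; nlinarith
      exact mul_le_mul (hM z hzC.1 hzC.2) h3 (Real.exp_pos _).le hM0
  have hdc : DiffContOnCl ℂ E (openHalf t b) := by
    refine ⟨hd.mul ?_, (hc.mono hcl).mul ?_⟩
    · exact (Differentiable.cexp (by fun_prop)).differentiableOn
    · exact (Differentiable.cexp (by fun_prop)).continuous.continuousOn
  have hwmem : w ∈ closure (openHalf t b) :=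
    closedHalf_subset_closure t b (closedHalf_mono (by simp; linarith) hw)
  have hfin := Complex.norm_le_of_forall_mem_frontier_norm_le
    ((isBounded_ball (x := (t : ℂ)) (r := b)).subset fun _ h => h.1) hdc hbound hwmem
  rw [hEn] at hfin
  have hlow : -(1 / 2) ≤ (h w).re := by
    have hn : ‖w - t‖ ≤ b / 5 := by
      have := hw.1
      rw [mem_ball, dist_eq_norm] at this; exact this.le
    have h1 : |w.im| ≤ b / 5 := by
      have := Complex.abs_im_le_norm (w - t); simp at this; linarith
    have h2 : |w.re - t| ≤ b / 5 := by
      have := Complex.abs_re_le_norm (w - t); simp at this; linarith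
    have h1' : w.im / b ≤ 1 / 5 := by
      rw [div_le_iff₀ hb]; linarith [le_abs_self w.im]
    have h2' : |(w.re - t) / b| ≤ 1 / 5 := by
      rw [abs_div, abs_of_pos hb, div_le_iff₀ hb]; linarith
    rw [hre]
    have h4 := sq_nonneg (w.im / b)
    have h5 : ((w.re - t) / b) ^ 2 ≤ (1 / 5) ^ 2 := sq_le_sq' (by linarith [abs_le.1 h2']) (by linarith [abs_le.1 h2'])
    linarith
  have h6 : Real.exp (-(N / 2)) ≤ Real.exp (N * (h w).re) := by
    apply Real.exp_le_exp.2; nlinarith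
  have h7 : ‖G w‖ * Real.exp (-(N / 2)) ≤ max ε (M * Real.exp (-N)) :=
    (mul_le_mul_of_nonneg_left h6 (norm_nonneg _)).trans hfin
  calc ‖G w‖ = Real.exp (N / 2) * (‖G w‖ * Real.exp (-(N / 2))) := by
        rw [mul_comm ‖G w‖, ← mul_assoc, ← Real.exp_add]; simp
    _ ≤ _ := by gcongr

/-! ### Boundary limits of holomorphic functions on an annulus -/

/-- Schwarz–Pick: follow `f` by the disc automorphism taking `f z` to `0`, apply the Schwarz lemma,
and use `1 - ‖a‖² ≤ 2 (1 - ‖a‖)`. -/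
theorem norm_deriv_le_of_mapsTo_unit_ball {f : ℂ → ℂ} {z : ℂ} {d : ℝ} (hd : 0 < d)
    (hf : DifferentiableOn ℂ f (ball z d)) (hm : MapsTo f (ball z d) (ball 0 1)) :
    ‖deriv f z‖ ≤ 2 * (1 - ‖f z‖) / d := by
  set a := f z with ha
  have ha1 : ‖a‖ < 1 := by simpa using hm (mem_ball_self hd)
  have hden : ∀ w : ℂ, ‖w‖ < 1 → 1 - (starRingEnd ℂ) a * w ≠ 0 := by
    intro w hw h
    have : ‖(starRingEnd ℂ) a * w‖ = 1 := by rw [← sub_eq_zero.1 h]; simp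
    rw [norm_mul, RCLike.norm_conj] at this
    nlinarith [norm_nonneg a, norm_nonneg w]
  set k : ℂ → ℂ := fun w => (f w - a) / (1 - (starRingEnd ℂ) a * f w) with hk
  have hk0 : k z = 0 := by simp [hk, ha]
  have hfm : ∀ w ∈ ball z d, ‖f w‖ < 1 := fun w hw => by simpa using hm hw
  have hkd : DifferentiableOn ℂ k (ball z d) := by
    refine (hf.sub_const a).div ?_ fun w hw => hden _ (hfm w hw)
    exact (hf.const_mul _).const_sub 1
  have hkm : MapsTo k (ball z d) (ball (k z) 1) := by
    intro w hw
    rw [hk0, mem_ball_zero_iff, norm_div, div_lt_one (norm_pos_iff.2 (hden _ (hfm w hw)))]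
    have h1 : ‖f w - a‖ ^ 2 < ‖1 - (starRingEnd ℂ) a * f w‖ ^ 2 := by
      have e1 : ‖f w‖ ^ 2 < 1 := by have := hfm w hw; nlinarith [norm_nonneg (f w)]
      have e2 : ‖a‖ ^ 2 < 1 := by nlinarith [norm_nonneg a]
      have e3 : ‖1 - (starRingEnd ℂ) a * f w‖ ^ 2 - ‖f w - a‖ ^ 2
          = (1 - ‖f w‖ ^ 2) * (1 - ‖a‖ ^ 2) := by
        simp only [Complex.sq_norm, Complex.normSq_apply]
        simp
        ring
      nlinarith
    exact lt_of_pow_lt_pow_left₀ 2 (norm_nonneg _) h1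
  have hkder : ‖deriv k z‖ ≤ 1 / d :=
    Complex.norm_deriv_le_div_of_mapsTo_ball hkd (hkm.mono_right ball_subset_closedBall) hd
  have hfz : DifferentiableAt ℂ f z := hf.differentiableAt (ball_mem_nhds z hd)
  have hder : deriv k z = deriv f z / (1 - (starRingEnd ℂ) a * a) := by
    have h1 : HasDerivAt (fun w => f w - a) (deriv f z) z := hfz.hasDerivAt.sub_const a
    have h2 : HasDerivAt (fun w => 1 - (starRingEnd ℂ) a * f w)
        (-((starRingEnd ℂ) a * deriv f z)) z := (hfz.hasDerivAt.const_mul _).const_sub 1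
    have h3 := (h1.div h2 (hden _ ha1)).deriv
    have h4 := hden _ ha1
    rw [hk]
    change deriv ((fun w => f w - a) / fun w => 1 - (starRingEnd ℂ) a * f w) z = _
    rw [h3]
    simp only [← ha, sub_self, zero_mul, sub_zero]
    field_simp
  have hnn : ‖1 - (starRingEnd ℂ) a * a‖ ≤ 2 * (1 - ‖a‖) := by
    have : 1 - (starRingEnd ℂ) a * a = ((1 - ‖a‖ ^ 2 : ℝ) : ℂ) := by
      rw [mul_comm, Complex.mul_conj, Complex.normSq_eq_norm_sq]; push_cast; ring
    rw [this, Complex.norm_real, Real.norm_eq_abs, abs_of_nonneg (by nlinarith [norm_nonneg a])]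
    nlinarith [norm_nonneg a]
  have hpos : 0 < ‖1 - (starRingEnd ℂ) a * a‖ := norm_pos_iff.2 (hden _ ha1)
  rw [hder, norm_div, div_le_iff₀ hpos] at hkder
  calc ‖deriv f z‖ ≤ 1 / d * ‖1 - (starRingEnd ℂ) a * a‖ := hkder
    _ ≤ 1 / d * (2 * (1 - ‖a‖)) := by gcongr
    _ = _ := by ring

/-- Maximum principle for `z ^ m / f z` on `σ < ‖z‖ < τ`. On the inner circle `‖f‖ > 1/2`, and `m`
is chosen with `σ ^ m < 1/2`; on the outer circle `‖f‖ > c`. The quotient is thus at most `1 / c`,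
and `c → 1`. The point is that `1 - ‖f z‖` is at most of the order of `1 - ‖z‖`. -/
theorem exists_pow_le_norm {f : ℂ → ℂ} {ρ : ℝ} (hρ : 0 < ρ) (hρ1 : ρ < 1)
    (hf : DifferentiableOn ℂ f {z | ρ < ‖z‖ ∧ ‖z‖ < 1})
    (hlim : ∀ c < 1, ∃ s < 1, ∀ z : ℂ, s < ‖z‖ → ‖z‖ < 1 → c < ‖f z‖) :
    ∃ σ, ρ < σ ∧ σ < 1 ∧ ∃ m : ℕ, ∀ z : ℂ, σ < ‖z‖ → ‖z‖ < 1 → ‖z‖ ^ m ≤ ‖f z‖ := by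
  obtain ⟨s, hs, hsf⟩ := hlim (1 / 2) (by norm_num)
  obtain ⟨σ, hσ1, hσ2⟩ := exists_between (max_lt hs hρ1)
  have hσs := (le_max_left _ _).trans_lt hσ1
  have hσρ := (le_max_right _ _).trans_lt hσ1
  have hσ0 : 0 < σ := hρ.trans hσρ
  obtain ⟨m, hm⟩ := exists_pow_lt_of_lt_one (show (0 : ℝ) < 1 / 2 by norm_num) hσ2
  refine ⟨σ, hσρ, hσ2, m, fun z hz hz1 => ?_⟩
  have hfz : 0 < ‖f z‖ := (by norm_num : (0 : ℝ) < 1 / 2).trans (hsf z (hσs.trans hz) hz1)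
  have key : ∀ c : ℝ, 0 < c → c < 1 → ‖z‖ ^ m / ‖f z‖ ≤ 1 / c := by
    intro c hc0 hc
    obtain ⟨s', hs', hsf'⟩ := hlim c hc
    obtain ⟨τ, hτ1, hτ2⟩ := exists_between (max_lt hs' hz1)
    have hτs := (le_max_left _ _).trans_lt hτ1
    have hτz := (le_max_right _ _).trans_lt hτ1
    set U : Set ℂ := {w | σ < ‖w‖ ∧ ‖w‖ < τ} with hU
    have hUo : IsOpen U := (isOpen_lt continuous_const continuous_norm).inter
      (isOpen_lt continuous_norm continuous_const)
    have hcl : closure U ⊆ {w | σ ≤ ‖w‖ ∧ ‖w‖ ≤ τ} :=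
      closure_minimal (fun w hw => ⟨hw.1.le, hw.2.le⟩)
        ((isClosed_le continuous_const continuous_norm).inter
          (isClosed_le continuous_norm continuous_const))
    have hne : ∀ w ∈ {w : ℂ | σ ≤ ‖w‖ ∧ ‖w‖ ≤ τ}, f w ≠ 0 := fun w hw h => by
      have := hsf w (hσs.trans_le hw.1) (hw.2.trans_lt hτ2)
      rw [h, norm_zero] at this; norm_num at this
    have hdiff : DifferentiableOn ℂ (fun w => w ^ m / f w) {w | σ ≤ ‖w‖ ∧ ‖w‖ ≤ τ} := by
      refine (by fun_prop : Differentiable ℂ fun w : ℂ => w ^ m).differentiableOn.div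
        (hf.mono fun w hw => ⟨hσρ.trans_le hw.1, hw.2.trans_lt hτ2⟩) hne
    have hb : Bornology.IsBounded U := (isBounded_ball (x := (0 : ℂ)) (r := τ)).subset
      fun w hw => by simpa using hw.2
    have hfr : ∀ w ∈ frontier U, ‖w ^ m / f w‖ ≤ 1 / c := by
      intro w hw
      rw [hUo.frontier_eq] at hw
      have hw1 := hcl hw.1
      rw [norm_div, norm_pow]
      rcases eq_or_lt_of_le hw1.1 with h | h
      · have h2 := hsf w (hσs.trans_le hw1.1) (hw1.2.trans_lt hτ2)
        rw [div_le_div_iff₀ (by linarith) hc0, ← h]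
        nlinarith [pow_pos hσ0 m]
      · have hτw : τ = ‖w‖ := by
          by_contra hne'
          exact hw.2 ⟨h, lt_of_le_of_ne hw1.2 (Ne.symm hne')⟩
        have h2 := hsf' w (by rw [← hτw]; exact hτs) (by rw [← hτw]; exact hτ2)
        have h3 : ‖w‖ ^ m ≤ 1 := pow_le_one₀ (norm_nonneg _) (by linarith)
        rw [div_le_div_iff₀ (by linarith) hc0]
        nlinarith [pow_nonneg (norm_nonneg w) m]
    have := Complex.norm_le_of_forall_mem_frontier_norm_le hb
      (⟨hdiff.mono (subset_closure.trans hcl), hdiff.continuousOn.mono hcl⟩ :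
        DiffContOnCl ℂ (fun w => w ^ m / f w) U) hfr (subset_closure ⟨hz, hτz⟩)
    rwa [norm_div, norm_pow] at this
  have hlim1 : ‖z‖ ^ m / ‖f z‖ ≤ 1 := by
    have ht : Tendsto (fun c : ℝ => 1 / c) (𝓝[<] 1) (𝓝 1) := by
      have : ContinuousAt (fun c : ℝ => 1 / c) 1 := by
        exact continuousAt_const.div continuousAt_id one_ne_zero
      have h := this.tendsto.mono_left (nhdsWithin_le_nhds (s := Iio 1))
      simpa using h
    refine ge_of_tendsto ht ?_
    filter_upwards [Ioo_mem_nhdsLT (show (0 : ℝ) < 1 by norm_num)] with c hc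
    exact key c hc.1 hc.2
  rwa [div_le_one hfz] at hlim1

/-- The bound `1 - ‖f z‖ ≤ m (1 - ‖z‖)` and Schwarz–Pick on the disc of radius `1 - ‖z‖` give `‖f'‖
≤ 2m` near the circle. So `f` is Lipschitz on a convex piece of the disc at `ζ`, hence has a limit
there. -/
theorem exists_tendsto_of_norm_tendsto_one {f : ℂ → ℂ} {ρ : ℝ} (hρ : 0 < ρ) (hρ1 : ρ < 1)
    (hf : DifferentiableOn ℂ f {z | ρ < ‖z‖ ∧ ‖z‖ < 1})
    (hm : ∀ z : ℂ, ρ < ‖z‖ → ‖z‖ < 1 → ‖f z‖ < 1)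
    (hlim : ∀ c < 1, ∃ s < 1, ∀ z : ℂ, s < ‖z‖ → ‖z‖ < 1 → c < ‖f z‖) {ζ : ℂ} (hζ : ‖ζ‖ = 1) :
    ∃ l : ℂ, ‖l‖ = 1 ∧ Tendsto f (𝓝[ball 0 1] ζ) (𝓝 l) := by
  obtain ⟨σ, hσ, hσ1, m, hpow⟩ := exists_pow_le_norm hρ hρ1 hf hlim
  have hUo : IsOpen {z : ℂ | ρ < ‖z‖ ∧ ‖z‖ < 1} := (isOpen_lt continuous_const continuous_norm).inter
      (isOpen_lt continuous_norm continuous_const)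
  have hder : ∀ z : ℂ, (1 + σ) / 2 < ‖z‖ → ‖z‖ < 1 → ‖deriv f z‖ ≤ 2 * m := by
    intro z hz hz1
    -- The threshold `(1 + σ) / 2` ensures `‖w‖ > 2‖z‖ - 1 > σ > ρ` on this disc.
    have hsub : ball z (1 - ‖z‖) ⊆ {w : ℂ | ρ < ‖w‖ ∧ ‖w‖ < 1} := by
      intro w hw
      rw [mem_ball, dist_eq_norm] at hw
      have h1 := norm_sub_norm_le w z
      have h2 := norm_sub_norm_le z w
      rw [norm_sub_rev z w] at h2
      constructor <;> linarith
    have h := norm_deriv_le_of_mapsTo_unit_ball (sub_pos.2 hz1) (hf.mono hsub)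
      (fun w hw => by simpa using hm w (hsub hw).1 (hsub hw).2)
    refine h.trans ?_
    rw [div_le_iff₀ (sub_pos.2 hz1)]
    have h1 := hpow z (by linarith) hz1
    -- Bernoulli: `‖z‖ ^ m ≥ 1 - m (1 - ‖z‖)`.
    have h2 := one_add_mul_le_pow (show (-2 : ℝ) ≤ -(1 - ‖z‖) by linarith [norm_nonneg z]) m
    have h3 : (1 + -(1 - ‖z‖)) = ‖z‖ := by ring
    rw [h3] at h2
    nlinarith
  set d := (1 - σ) / 2 with hd
  have hd0 : 0 < d := by rw [hd]; linarith
  set W : Set ℂ := ball ζ d ∩ ball 0 1 with hW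
  have hWsub : ∀ w ∈ W, (1 + σ) / 2 < ‖w‖ ∧ ‖w‖ < 1 := by
    rintro w ⟨h1, h2⟩
    rw [mem_ball, dist_eq_norm] at h1
    have h3 := norm_sub_norm_le ζ w
    rw [norm_sub_rev, hζ] at h3
    exact ⟨by linarith, by simpa using h2⟩
  have hLip : LipschitzOnWith (2 * m) f W := by
    refine Convex.lipschitzOnWith_of_nnnorm_deriv_le (𝕜 := ℂ) (fun w hw => ?_) (fun w hw => ?_)
      ((convex_ball ζ d).inter (convex_ball 0 1))
    · exact hf.differentiableAt (hUo.mem_nhds ⟨by linarith [(hWsub w hw).1], (hWsub w hw).2⟩)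
    · have := hder w (hWsub w hw).1 (hWsub w hw).2
      exact_mod_cast this
  have hne : (𝓝[ball 0 1] ζ).NeBot := by
    rw [← mem_closure_iff_nhdsWithin_neBot, closure_ball _ one_ne_zero]
    simp [hζ]
  have hWm : W ∈ 𝓝[ball 0 1] ζ :=
    inter_mem (mem_nhdsWithin_of_mem_nhds (ball_mem_nhds ζ hd0)) self_mem_nhdsWithin
  have hcau : Cauchy (map f (𝓝[ball 0 1] ζ)) := by
    have h1 : Cauchy (𝓝[ball 0 1] ζ) := cauchy_nhds.mono nhdsWithin_le_nhds
    have h2 := hLip.uniformContinuousOn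
    rw [uniformContinuousOn_iff_restrict] at h2
    have h3 : Cauchy (comap ((↑) : W → ℂ) (𝓝[ball 0 1] ζ)) := by
      refine h1.comap' le_rfl ?_
      exact comap_coe_neBot_of_le_principal (le_principal_iff.2 hWm)
    have h4 := h3.map h2
    have h5 : map (W.domRestrict f) (comap ((↑) : W → ℂ) (𝓝[ball 0 1] ζ)) = map f (𝓝[ball 0 1] ζ) := by
      rw [domRestrict_eq, ← map_map, map_comap_of_mem]
      rwa [Subtype.range_coe]
    rwa [h5] at h4
  obtain ⟨l, hl⟩ := CompleteSpace.complete hcau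
  refine ⟨l, le_antisymm ?_ ?_, hl⟩
  · refine le_of_tendsto (Tendsto.norm hl) ?_
    filter_upwards [hWm] with w hw
    exact (hm w (by linarith [(hWsub w hw).1]) (hWsub w hw).2).le
  · refine le_of_forall_lt fun c hc => ?_
    obtain ⟨c', hc1, hc2⟩ := exists_between hc
    obtain ⟨s, hs, hsf⟩ := hlim c' hc2
    refine hc1.trans_le (ge_of_tendsto (Tendsto.norm hl) ?_)
    have : ∀ᶠ w in 𝓝[ball 0 1] ζ, s < ‖w‖ :=
      nhdsWithin_le_nhds ((isOpen_lt continuous_const continuous_norm).mem_nhds (by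
        change s < ‖ζ‖; rw [hζ]; exact hs))
    filter_upwards [this, self_mem_nhdsWithin] with w h1 h2
    exact (hsf w h1 (by simpa using h2)).le

/-! ### Sides of an analytic Jordan curve -/

/-- The open annulus `r < ‖z‖ < R`. -/
def annulus (r R : ℝ) : Set ℂ := {z : ℂ | r < ‖z‖ ∧ ‖z‖ < R}

theorem isOpen_annulus (r R : ℝ) : IsOpen (annulus r R) :=
  (isOpen_lt continuous_const continuous_norm).inter (isOpen_lt continuous_norm continuous_const)

theorem isPreconnected_annulus {r R : ℝ} (hr : 0 ≤ r) : IsPreconnected (annulus r R) := by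
  have h : annulus r R =
      (fun p : ℝ × ℝ => (p.1 : ℂ) * Complex.exp (p.2 * Complex.I)) '' (Ioo r R ×ˢ univ) := by
    ext z
    constructor
    · rintro ⟨h1, h2⟩
      exact ⟨(‖z‖, z.arg), ⟨⟨h1, h2⟩, mem_univ _⟩, Complex.norm_mul_exp_arg_mul_I z⟩
    · rintro ⟨⟨s, t⟩, ⟨⟨h1, h2⟩, -⟩, rfl⟩
      have : ‖(s : ℂ) * Complex.exp (t * Complex.I)‖ = s := by
        rw [norm_mul, Complex.norm_exp_ofReal_mul_I, mul_one, Complex.norm_real, Real.norm_eq_abs,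
          abs_of_pos (by simp only at h1; linarith)]
      simp only [annulus, mem_ofPred_eq, this]
      exact ⟨h1, h2⟩
  rw [h]
  exact (isPreconnected_Ioo.prod isPreconnected_univ).image _ (by fun_prop)

theorem boundedSide_subset_compl (K : Set ℂ) : boundedSide K ⊆ Kᶜ := fun _ h => h.1

theorem unboundedSide_subset_compl (K : Set ℂ) : unboundedSide K ⊆ Kᶜ := fun _ h => h.1

theorem not_mem_unboundedSide {K : Set ℂ} {z : ℂ} (h : z ∈ boundedSide K) :
    z ∉ unboundedSide K := fun h' => h'.2 h.2

theorem subset_boundedSide_of_mem {K V : Set ℂ} (hV : IsPreconnected V) (hVK : V ⊆ Kᶜ) {z : ℂ}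
    (hz : z ∈ V) (hzb : z ∈ boundedSide K) : V ⊆ boundedSide K := by
  intro w hw
  refine ⟨hVK hw, ?_⟩
  rw [← connectedComponentIn_eq (hV.subset_connectedComponentIn hz hVK hw)]
  exact hzb.2

theorem subset_unboundedSide_of_mem {K V : Set ℂ} (hV : IsPreconnected V) (hVK : V ⊆ Kᶜ) {z : ℂ}
    (hz : z ∈ V) (hzb : z ∈ unboundedSide K) : V ⊆ unboundedSide K := by
  intro w hw
  refine ⟨hVK hw, ?_⟩
  rw [← connectedComponentIn_eq (hV.subset_connectedComponentIn hz hVK hw)]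
  exact hzb.2

theorem isOpen_unboundedSide {K : Set ℂ} (hK : IsClosed K) : IsOpen (unboundedSide K) := by
  rw [isOpen_iff_mem_nhds]
  intro z hz
  exact mem_of_superset
    ((hK.isOpen_compl.connectedComponentIn).mem_nhds (mem_connectedComponentIn hz.1))
    (subset_unboundedSide_of_mem isPreconnected_connectedComponentIn
      (connectedComponentIn_subset _ _) (mem_connectedComponentIn hz.1) hz)

/-- The radial ray from `z` to infinity is connected, unbounded and misses `K`. -/
theorem compl_closedBall_subset_unboundedSide {K : Set ℂ} {ρ : ℝ} (hρ : 0 ≤ ρ)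
    (hK : K ⊆ closedBall 0 ρ) : (closedBall (0 : ℂ) ρ)ᶜ ⊆ unboundedSide K := by
  intro z hz
  have hzn : ρ < ‖z‖ := by simpa using hz
  have hzK : z ∈ Kᶜ := fun h => hz (hK h)
  refine ⟨hzK, fun hb => ?_⟩
  set L : Set ℂ := (fun s : ℝ => (s : ℂ) * z) '' Ici 1 with hL
  have hLp : IsPreconnected L := isPreconnected_Ici.image _ (by fun_prop)
  have hLK : L ⊆ Kᶜ := by
    rintro _ ⟨s, hs, rfl⟩ h
    have h1 := hK h
    rw [mem_closedBall_zero_iff, norm_mul, Complex.norm_real, Real.norm_eq_abs,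
      abs_of_pos (zero_lt_one.trans_le hs)] at h1
    have h2 : (1 : ℝ) ≤ s := hs
    nlinarith
  have hzL : z ∈ L := ⟨1, self_mem_Ici, by simp⟩
  obtain ⟨C, hC⟩ := (hb.subset (hLp.subset_connectedComponentIn hzL hLK)).exists_norm_le
  have hz0 : 0 < ‖z‖ := hρ.trans_lt hzn
  have h1 := hC _ ⟨max 1 ((C + 1) / ‖z‖), mem_Ici.2 (le_max_left _ _), rfl⟩
  rw [norm_mul, Complex.norm_real, Real.norm_eq_abs,
      abs_of_pos (zero_lt_one.trans_le (le_max_left _ _))] at h1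
  have h2 : (C + 1) / ‖z‖ * ‖z‖ = C + 1 := by field_simp
  have h3 := mul_le_mul_of_nonneg_right (le_max_right 1 ((C + 1) / ‖z‖)) hz0.le
  linarith

/-- A component missing `U \ K` would stay away from `K`, hence be open and closed in the plane. -/
theorem connectedComponentIn_compl_inter_nonempty {K U : Set ℂ} (hK : IsClosed K)
    (hne : K.Nonempty) (hU : IsOpen U) (hKU : K ⊆ U) {z : ℂ} (hz : z ∈ Kᶜ) :
    (connectedComponentIn Kᶜ z ∩ (U \ K)).Nonempty := by
  by_contra hem
  rw [not_nonempty_iff_eq_empty] at hem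
  set C := connectedComponentIn Kᶜ z with hC
  have hCK : C ⊆ Kᶜ := connectedComponentIn_subset _ _
  have hCU : Disjoint C U := by
    rw [disjoint_left]
    intro w hw hwU
    have : w ∈ C ∩ (U \ K) := ⟨hw, hwU, hCK hw⟩
    rw [hem] at this
    exact this
  have hCo : IsOpen C := hK.isOpen_compl.connectedComponentIn
  have hCc : IsClosed C := by
    refine isClosed_of_closure_subset fun p hp => ?_
    have hpK : p ∉ K := fun h =>
      (disjoint_left.1 (hCU.closure_left hU)) hp (hKU h)
    obtain ⟨q, hq1, hq2⟩ := mem_closure_iff.1 hp _ (hK.isOpen_compl.connectedComponentIn)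
      (mem_connectedComponentIn (F := Kᶜ) hpK)
    rw [hC, connectedComponentIn_eq hq2, ← connectedComponentIn_eq hq1]
    exact mem_connectedComponentIn hpK
  have := IsClopen.eq_univ ⟨hCc, hCo⟩ ⟨z, mem_connectedComponentIn hz⟩
  obtain ⟨k, hk⟩ := hne
  exact hCK (this ▸ mem_univ k) hk

/-- `Ψ` maps the annulus `r < ‖z‖ < R` conformally onto a neighbourhood of `K`, the unit circle
onto `K`, the inner part of the annulus into `S` and the outer part off `S`. -/
structure IsCollar (K S : Set ℂ) (Ψ : ℂ → ℂ) (r R : ℝ) : Prop where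
  r_pos : 0 < r
  r_lt : r < 1
  lt_R : 1 < R
  diff : DifferentiableOn ℂ Ψ (annulus r R)
  inj : InjOn Ψ (annulus r R)
  circle : Ψ '' sphere 0 1 = K
  disj : S ⊆ Kᶜ
  inner : ∀ z : ℂ, r < ‖z‖ → ‖z‖ < 1 → Ψ z ∈ S
  outer : ∀ z : ℂ, 1 < ‖z‖ → ‖z‖ < R → Ψ z ∉ S

theorem sphere_subset_annulus {r R : ℝ} (hr : r < 1) (hR : 1 < R) :
    sphere (0 : ℂ) 1 ⊆ annulus r R := fun z hz => by
  have : ‖z‖ = 1 := by simpa using hz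
  simp [annulus, this, hr, hR]

/-- The Jordan curve theorem is not needed. Off `K` the collar consists of two connected halves, and
every component of the complement meets one of them. Since both sides are nonempty and disjoint,
each contains exactly one half. Either half may be the inner one; precomposing with `z ↦ z⁻¹`
exchanges them. -/
theorem exists_isCollar {K : Set ℂ} {Φ : ℂ → ℂ} {r R : ℝ} (hr : 0 < r) (hr1 : r < 1) (hR : 1 < R)
    (hd : DifferentiableOn ℂ Φ (annulus r R)) (hi : InjOn Φ (annulus r R))
    (hK : Φ '' sphere 0 1 = K) (hb : (boundedSide K).Nonempty) :
    (∃ Ψ r R, IsCollar K (boundedSide K) Ψ r R) ∧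
      (∃ Ψ r R, IsCollar K (unboundedSide K) Ψ r R) := by
  have hsub := sphere_subset_annulus hr1 hR
  have hKc : IsCompact K := hK ▸ (isCompact_sphere 0 1).image_of_continuousOn
    (hd.continuousOn.mono hsub)
  have hKne : K.Nonempty := ⟨Φ 1, hK ▸ mem_image_of_mem Φ (by simp)⟩
  set U := Φ '' annulus r R with hU
  have hUo : IsOpen U := isOpen_image_of_injOn (isOpen_annulus r R) hd hi (isOpen_annulus r R)
    subset_rfl
  have hKU : K ⊆ U := hK ▸ image_mono hsub
  have hs1 : annulus r 1 ⊆ annulus r R := fun z hz => ⟨hz.1, hz.2.trans hR⟩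
  have hs2 : annulus 1 R ⊆ annulus r R := fun z hz => ⟨hr1.trans hz.1, hz.2⟩
  have hp1 : IsPreconnected (Φ '' annulus r 1) :=
    (isPreconnected_annulus hr.le).image _ (hd.continuousOn.mono hs1)
  have hp2 : IsPreconnected (Φ '' annulus 1 R) :=
    (isPreconnected_annulus zero_le_one).image _ (hd.continuousOn.mono hs2)
  have hnotK : ∀ z ∈ annulus r R, ‖z‖ ≠ 1 → Φ z ∉ K := by
    intro z hz hne h
    rw [← hK] at h
    obtain ⟨w, hw, hwz⟩ := h
    exact hne (by rw [← hi (hsub hw) hz hwz]; simpa using hw)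
  have hk1 : Φ '' annulus r 1 ⊆ Kᶜ := by
    rintro _ ⟨z, hz, rfl⟩
    exact hnotK z (hs1 hz) hz.2.ne
  have hk2 : Φ '' annulus 1 R ⊆ Kᶜ := by
    rintro _ ⟨z, hz, rfl⟩
    exact hnotK z (hs2 hz) hz.1.ne'
  have hsplit : ∀ p ∈ U \ K, p ∈ Φ '' annulus r 1 ∨ p ∈ Φ '' annulus 1 R := by
    rintro _ ⟨⟨z, hz, rfl⟩, hzK⟩
    rcases lt_trichotomy ‖z‖ 1 with h | h | h
    · exact Or.inl (mem_image_of_mem Φ ⟨hz.1, h⟩)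
    · exact absurd (hK ▸ mem_image_of_mem Φ (by simpa using h)) hzK
    · exact Or.inr (mem_image_of_mem Φ ⟨h, hz.2⟩)
  have hB : Φ '' annulus r 1 ⊆ boundedSide K ∨ Φ '' annulus 1 R ⊆ boundedSide K := by
    obtain ⟨b, hb⟩ := hb
    obtain ⟨p, hpC, hpU⟩ := connectedComponentIn_compl_inter_nonempty hKc.isClosed hKne hUo hKU hb.1
    have hpb := subset_boundedSide_of_mem isPreconnected_connectedComponentIn
      (connectedComponentIn_subset _ _) (mem_connectedComponentIn hb.1) hb hpC
    exact (hsplit p hpU).imp (fun h => subset_boundedSide_of_mem hp1 hk1 h hpb)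
      (fun h => subset_boundedSide_of_mem hp2 hk2 h hpb)
  have hUn : Φ '' annulus r 1 ⊆ unboundedSide K ∨ Φ '' annulus 1 R ⊆ unboundedSide K := by
    obtain ⟨ρ, hρ, hKρ⟩ := hKc.isBounded.subset_closedBall_lt 0 0
    have hb : ((ρ + 1 : ℝ) : ℂ) ∈ unboundedSide K :=
      compl_closedBall_subset_unboundedSide hρ.le hKρ (by
        rw [mem_compl_iff, mem_closedBall_zero_iff, Complex.norm_real, Real.norm_eq_abs,
          abs_of_pos (by linarith)]
        linarith)
    obtain ⟨p, hpC, hpU⟩ := connectedComponentIn_compl_inter_nonempty hKc.isClosed hKne hUo hKU hb.1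
    have hpb := subset_unboundedSide_of_mem isPreconnected_connectedComponentIn
      (connectedComponentIn_subset _ _) (mem_connectedComponentIn hb.1) hb hpC
    exact (hsplit p hpU).imp (fun h => subset_unboundedSide_of_mem hp1 hk1 h hpb)
      (fun h => subset_unboundedSide_of_mem hp2 hk2 h hpb)
  have hn1 : ∃ z : ℂ, z ∈ annulus r 1 := by
    refine ⟨((r + 1) / 2 : ℝ), ?_⟩
    rw [annulus, mem_ofPred_eq, Complex.norm_real, Real.norm_eq_abs, abs_of_pos (by linarith)]
    constructor <;> linarith
  have hn2 : ∃ z : ℂ, z ∈ annulus 1 R := by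
    refine ⟨((R + 1) / 2 : ℝ), ?_⟩
    rw [annulus, mem_ofPred_eq, Complex.norm_real, Real.norm_eq_abs, abs_of_pos (by linarith)]
    constructor <;> linarith
  have collar : ∀ {S}, S ⊆ Kᶜ → (∀ z ∈ annulus r 1, Φ z ∈ S) → (∀ z ∈ annulus 1 R, Φ z ∉ S) →
      ∃ Ψ r R, IsCollar K S Ψ r R := fun hSK h1 h2 =>
    ⟨Φ, r, R, hr, hr1, hR, hd, hi, hK, hSK, fun z ha hb => h1 z ⟨ha, hb⟩,
      fun z ha hb => h2 z ⟨ha, hb⟩⟩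
  have collar' : ∀ {S}, S ⊆ Kᶜ → (∀ z ∈ annulus r 1, Φ z ∉ S) → (∀ z ∈ annulus 1 R, Φ z ∈ S) →
      ∃ Ψ r R, IsCollar K S Ψ r R := by
    intro S hSK h1 h2
    have hR0 : 0 < R := by linarith
    have hlt1 : ∀ z : ℂ, 0 < ‖z‖ → (‖z‖ < r⁻¹ ↔ r < ‖z⁻¹‖) := fun z hz => by
      rw [norm_inv, lt_inv_comm₀ hz hr]
    have hlt2 : ∀ z : ℂ, 0 < ‖z‖ → (R⁻¹ < ‖z‖ ↔ ‖z⁻¹‖ < R) := fun z hz => by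
      rw [norm_inv, inv_lt_comm₀ hR0 hz]
    have hmaps : MapsTo (fun z : ℂ => z⁻¹) (annulus R⁻¹ r⁻¹) (annulus r R) := fun z hz => by
      have hz0 : 0 < ‖z‖ := (inv_pos.2 hR0).trans hz.1
      exact ⟨(hlt1 z hz0).1 hz.2, (hlt2 z hz0).1 hz.1⟩
    refine ⟨fun z => Φ z⁻¹, R⁻¹, r⁻¹, inv_pos.2 hR0, inv_lt_one_of_one_lt₀ hR,
      (one_lt_inv₀ hr).2 hr1, ?_, ?_, ?_, hSK, ?_, ?_⟩
    · refine hd.comp (fun z hz => ?_) hmaps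
      exact (differentiableAt_inv (norm_pos_iff.1 ((inv_pos.2 hR0).trans hz.1))).differentiableWithinAt
    · intro z hz w hw h
      exact inv_injective (hi (hmaps hz) (hmaps hw) h)
    · rw [← hK]
      ext p
      constructor
      · rintro ⟨z, hz, rfl⟩
        exact ⟨z⁻¹, by simpa using hz, rfl⟩
      · rintro ⟨z, hz, rfl⟩
        exact ⟨z⁻¹, by simpa using hz, by simp⟩
    · intro z ha hb
      have hz0 : 0 < ‖z‖ := (inv_pos.2 hR0).trans ha
      exact h2 _ ⟨by rw [norm_inv]; exact (one_lt_inv₀ hz0).2 hb, (hlt2 z hz0).1 ha⟩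
    · intro z ha hb
      have hz0 : 0 < ‖z‖ := zero_lt_one.trans ha
      exact h1 _ ⟨(hlt1 z hz0).1 hb, by rw [norm_inv]; exact inv_lt_one_of_one_lt₀ ha⟩
  have hbK := boundedSide_subset_compl K
  have huK := unboundedSide_subset_compl K
  rcases hB with hB | hB <;> rcases hUn with hUn | hUn
  · obtain ⟨z, hz⟩ := hn1
    exact absurd (hUn (mem_image_of_mem Φ hz)) (not_mem_unboundedSide (hB (mem_image_of_mem Φ hz)))
  · exact ⟨collar hbK (fun z hz => hB (mem_image_of_mem Φ hz))
      (fun z hz h => not_mem_unboundedSide h (hUn (mem_image_of_mem Φ hz))),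
      collar' huK (fun z hz => not_mem_unboundedSide (hB (mem_image_of_mem Φ hz)))
      (fun z hz => hUn (mem_image_of_mem Φ hz))⟩
  · exact ⟨collar' hbK (fun z hz h => not_mem_unboundedSide h (hUn (mem_image_of_mem Φ hz)))
      (fun z hz => hB (mem_image_of_mem Φ hz)),
      collar huK (fun z hz => hUn (mem_image_of_mem Φ hz))
      (fun z hz => not_mem_unboundedSide (hB (mem_image_of_mem Φ hz)))⟩
  · obtain ⟨z, hz⟩ := hn2
    exact absurd (hUn (mem_image_of_mem Φ hz)) (not_mem_unboundedSide (hB (mem_image_of_mem Φ hz)))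

/-! ### Boundary values of the Riemann map -/

namespace IsCollar

variable {K S : Set ℂ} {Ψ : ℂ → ℂ} {r R : ℝ}

theorem isCompact (h : IsCollar K S Ψ r R) : IsCompact K :=
  h.circle ▸ (isCompact_sphere 0 1).image_of_continuousOn
    (h.diff.continuousOn.mono (sphere_subset_annulus h.r_lt h.lt_R))

theorem map_mem (h : IsCollar K S Ψ r R) {z : ℂ} (hz : ‖z‖ = 1) : Ψ z ∈ K :=
  h.circle ▸ mem_image_of_mem Ψ (by simpa using hz)

theorem continuousAt (h : IsCollar K S Ψ r R) {z : ℂ} (hz : z ∈ annulus r R) :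
    ContinuousAt Ψ z :=
  h.diff.continuousOn.continuousAt ((isOpen_annulus r R).mem_nhds hz)

theorem norm_lt_one_of_mem (h : IsCollar K S Ψ r R) {z : ℂ} (hz : z ∈ annulus r R)
    (hS : Ψ z ∈ S) : ‖z‖ < 1 := by
  rcases lt_trichotomy ‖z‖ 1 with h1 | h1 | h1
  · exact h1
  · exact absurd (h.map_mem h1) (h.disj hS)
  · exact absurd hS (h.outer z h1 hz.2)

end IsCollar

/-- With `g` and `ψ` the inverses of `Ψ` and `φ`, the maps `g ∘ φ` and `ψ ∘ Ψ` have modulus tending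
to `1` at the circle, so they have boundary limits `τ` and `κ`. As the two maps invert each other
near the circle, so do `τ` and `κ`, and `φ = Ψ ∘ (g ∘ φ)` tends to `Ψ (τ ζ)`. -/
theorem exists_boundary_correspondence {K : Set ℂ} {Ψ φ : ℂ → ℂ} {r R : ℝ}
    (hC : IsCollar K (boundedSide K) Ψ r R) (hφ : IsRiemannMap φ (boundedSide K)) :
    ∃ τ : ℂ → ℂ, BijOn τ (sphere 0 1) (sphere 0 1) ∧
      ∀ ζ ∈ sphere (0 : ℂ) 1, Tendsto φ (𝓝[ball 0 1] ζ) (𝓝 (Ψ (τ ζ))) := by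
  obtain ⟨hφd, hφb⟩ := hφ
  set Ω := boundedSide K with hΩ
  have hKc := hC.isCompact
  set A := annulus r R with hA
  have hAo : IsOpen A := isOpen_annulus r R
  set ψ := Function.invFunOn φ (ball 0 1) with hψ
  have hψd : DifferentiableOn ℂ ψ Ω := by
    rw [← hφb.image_eq]
    exact differentiableOn_invFunOn isOpen_ball hφd hφb.injOn
  have hψl : ∀ {w}, w ∈ ball (0 : ℂ) 1 → ψ (φ w) = w := fun hw => hφb.injOn.leftInvOn_invFunOn hw
  have hψm : ∀ {p}, p ∈ Ω → ψ p ∈ ball (0 : ℂ) 1 ∧ φ (ψ p) = p := fun hp => by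
    rw [← hφb.image_eq] at hp
    exact ⟨Function.invFunOn_mem hp, Function.invFunOn_eq hp⟩
  set g := Function.invFunOn Ψ A with hg
  have hgd : DifferentiableOn ℂ g (Ψ '' A) := differentiableOn_invFunOn hAo hC.diff hC.inj
  have hgl : ∀ {z}, z ∈ A → g (Ψ z) = z := fun hz => hC.inj.leftInvOn_invFunOn hz
  have hprop1 : ∀ s < 1, ∃ ρ < 1, 0 < ρ ∧ ∀ w : ℂ, ρ < ‖w‖ → ‖w‖ < 1 →
      ∃ z ∈ A, s < ‖z‖ ∧ ‖z‖ < 1 ∧ Ψ z = φ w := by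
    intro s hs
    have hsub : annulus (max r s) R ⊆ A := fun z hz => ⟨(le_max_left _ _).trans_lt hz.1, hz.2⟩
    have hUo : IsOpen (Ψ '' annulus (max r s) R) :=
      isOpen_image_of_injOn hAo hC.diff hC.inj (isOpen_annulus _ _) hsub
    -- The part of `Ω` outside a thin collar. Removing an open neighbourhood of `K` makes it
    -- compact, so `ψ` sends it into a smaller disc.
    set Q := (unboundedSide K)ᶜ \ Ψ '' annulus (max r s) R with hQ
    have hQc : IsCompact Q := by
      obtain ⟨ρ, hρ, hKρ⟩ := hKc.isBounded.subset_closedBall_lt 0 0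
      refine (isCompact_closedBall (0 : ℂ) ρ).of_isClosed_subset
        ((isOpen_unboundedSide hKc.isClosed).isClosed_compl.inter hUo.isClosed_compl) ?_
      exact fun p hp => by_contra fun h =>
        hp.1 (compl_closedBall_subset_unboundedSide hρ.le hKρ h)
    have hQΩ : Q ⊆ Ω := by
      rintro p ⟨hp1, hp2⟩
      have hpK : p ∉ K := fun hpK => hp2 (by
        rw [← hC.circle] at hpK
        exact image_mono (sphere_subset_annulus (max_lt hC.r_lt hs) hC.lt_R) hpK)
      by_contra hpb
      exact hp1 ⟨hpK, fun hb => hpb ⟨hpK, hb⟩⟩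
    obtain ⟨ρ, ⟨hρ0, hρ1⟩, hρs⟩ := exists_pos_lt_subset_ball one_pos
      (hQc.image_of_continuousOn (hψd.continuousOn.mono hQΩ)).isClosed
      (show ψ '' Q ⊆ ball (0 : ℂ) 1 by
        rintro _ ⟨p, hp, rfl⟩
        exact (hψm (hQΩ hp)).1)
    refine ⟨ρ, hρ1, hρ0, fun w hw hw1 => ?_⟩
    have hwb : w ∈ ball (0 : ℂ) 1 := by simpa using hw1
    have hwΩ : φ w ∈ Ω := hφb.mapsTo hwb
    have : φ w ∈ Ψ '' annulus (max r s) R := by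
      by_contra hn
      have h1 := hρs ⟨φ w, ⟨not_mem_unboundedSide hwΩ, hn⟩, hψl hwb⟩
      rw [mem_ball_zero_iff] at h1
      linarith
    obtain ⟨z, hz, hzw⟩ := this
    exact ⟨z, hsub hz, (le_max_right _ _).trans_lt hz.1,
      hC.norm_lt_one_of_mem (hsub hz) (hzw ▸ hwΩ), hzw⟩
  have hprop2 : ∀ c < 1, ∃ s < 1, ∀ z : ℂ, s < ‖z‖ → ‖z‖ < 1 → c < ‖ψ (Ψ z)‖ := by
    intro c hc
    set s0 := (1 + r) / 2 with hs0
    have hrs : r < s0 := by rw [hs0]; linarith [hC.r_lt]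
    have hs01 : s0 < 1 := by rw [hs0]; linarith [hC.r_lt]
    set T := (closedBall (0 : ℂ) 1 ∩ {z | s0 ≤ ‖z‖}) with hT
    have hTA : T ⊆ A := fun z hz => ⟨hrs.trans_le hz.2, by
      have : ‖z‖ ≤ 1 := by simpa using hz.1
      exact this.trans_lt hC.lt_R⟩
    have hTc : IsClosed T := isClosed_closedBall.inter (isClosed_le continuous_const continuous_norm)
    have hsubb : closedBall (0 : ℂ) c ⊆ ball 0 1 := closedBall_subset_ball hc
    have hCc : IsCompact (φ '' closedBall 0 c) :=
      (isCompact_closedBall 0 c).image_of_continuousOn (hφd.continuousOn.mono hsubb)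
    have hcl : IsClosed (T ∩ Ψ ⁻¹' (φ '' closedBall 0 c)) :=
      (hC.diff.continuousOn.mono hTA).preimage_isClosed_of_isClosed hTc hCc.isClosed
    -- The preimage of the compact set `φ '' closedBall 0 c` avoids the unit circle, which `Ψ` maps
    -- into `K`; being closed, it stays within a smaller disc.
    obtain ⟨s, ⟨hs0', hs1⟩, hss⟩ := exists_pos_lt_subset_ball one_pos hcl
      (show T ∩ Ψ ⁻¹' (φ '' closedBall 0 c) ⊆ ball (0 : ℂ) 1 by
        rintro z ⟨hzT, w, hw, hwz⟩
        rw [mem_ball_zero_iff]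
        exact hC.norm_lt_one_of_mem (hTA hzT) (hwz ▸ hφb.mapsTo (hsubb hw)))
    refine ⟨max s s0, max_lt hs1 hs01, fun z hz hz1 => ?_⟩
    by_contra hn
    rw [not_lt] at hn
    have hzs0 := (le_max_right s s0).trans_lt hz
    have h1 := hss ⟨⟨by simpa using hz1.le, hzs0.le⟩, ψ (Ψ z), by simpa using hn,
      (hψm (hC.inner z (hrs.trans hzs0) hz1)).2⟩
    rw [mem_ball_zero_iff] at h1
    exact (h1.trans ((le_max_left s s0).trans_lt hz)).false
  obtain ⟨ρ, hρ1, hρ0, hρ⟩ := hprop1 0 one_pos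
  have hg1 : ∀ w : ℂ, ρ < ‖w‖ → ‖w‖ < 1 → g (φ w) ∈ A ∧ ‖g (φ w)‖ < 1 ∧ Ψ (g (φ w)) = φ w := by
    intro w hw hw1
    obtain ⟨z, hzA, -, hz1, hzw⟩ := hρ w hw hw1
    rw [← hzw, hgl hzA]
    exact ⟨hzA, hz1, rfl⟩
  have hL1 : ∀ ζ : ℂ, ‖ζ‖ = 1 → ∃ l : ℂ, ‖l‖ = 1 ∧
      Tendsto (fun w => g (φ w)) (𝓝[ball 0 1] ζ) (𝓝 l) := by
    intro ζ hζ
    refine exists_tendsto_of_norm_tendsto_one hρ0 hρ1 ?_ (fun w hw hw1 => (hg1 w hw hw1).2.1) ?_ hζ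
    · refine hgd.comp (hφd.mono fun w hw => by simpa using hw.2) fun w hw => ?_
      exact ⟨_, (hg1 w hw.1 hw.2).1, (hg1 w hw.1 hw.2).2.2⟩
    · intro c hc
      obtain ⟨σ, hσ1, hσ0, hσ⟩ := hprop1 c hc
      refine ⟨σ, hσ1, fun w hw hw1 => ?_⟩
      obtain ⟨z, hzA, hcz, -, hzw⟩ := hσ w hw hw1
      rwa [← hzw, hgl hzA]
  have hL2 : ∀ ζ : ℂ, ‖ζ‖ = 1 → ∃ l : ℂ, ‖l‖ = 1 ∧
      Tendsto (fun z => ψ (Ψ z)) (𝓝[ball 0 1] ζ) (𝓝 l) := by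
    intro ζ hζ
    refine exists_tendsto_of_norm_tendsto_one hC.r_pos hC.r_lt ?_ (fun z hz hz1 => ?_) hprop2 hζ
    · exact hψd.comp (hC.diff.mono fun z hz => ⟨hz.1, hz.2.trans hC.lt_R⟩)
        fun z hz => hC.inner z hz.1 hz.2
    · simpa using (hψm (hC.inner z hz hz1)).1
  choose! τ hτ1 hτ using hL1
  choose! κ hκ1 hκ using hL2
  have hball : ∀ ζ : ℂ, ‖ζ‖ = 1 → ∀ s < 1, ∀ᶠ w in 𝓝[ball 0 1] ζ, s < ‖w‖ ∧ ‖w‖ < 1 := by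
    intro ζ hζ s hs
    have : ∀ᶠ w in 𝓝[ball 0 1] ζ, s < ‖w‖ :=
      nhdsWithin_le_nhds ((isOpen_lt continuous_const continuous_norm).mem_nhds (by
        change s < ‖ζ‖; rw [hζ]; exact hs))
    filter_upwards [this, self_mem_nhdsWithin] with w h1 h2
    exact ⟨h1, by simpa using h2⟩
  have hnebot : ∀ ζ : ℂ, ‖ζ‖ = 1 → (𝓝[ball 0 1] ζ).NeBot := by
    intro ζ hζ
    rw [← mem_closure_iff_nhdsWithin_neBot, closure_ball _ one_ne_zero]
    simp [hζ]
  have hid : ∀ ζ : ℂ, Tendsto (fun w : ℂ => w) (𝓝[ball 0 1] ζ) (𝓝 ζ) := fun ζ =>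
    tendsto_id.mono_left nhdsWithin_le_nhds
  have hκτ : ∀ ζ : ℂ, ‖ζ‖ = 1 → κ (τ ζ) = ζ := by
    intro ζ hζ
    have := hnebot ζ hζ
    have h1 : Tendsto (fun w => g (φ w)) (𝓝[ball 0 1] ζ) (𝓝[ball 0 1] (τ ζ)) := by
      refine tendsto_nhdsWithin_iff.2 ⟨hτ ζ hζ, ?_⟩
      filter_upwards [hball ζ hζ ρ hρ1] with w hw
      simpa using (hg1 w hw.1 hw.2).2.1
    refine tendsto_nhds_unique ((hκ (τ ζ) (hτ1 ζ hζ)).comp h1) ((hid ζ).congr' ?_)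
    filter_upwards [hball ζ hζ ρ hρ1] with w hw
    simp only [Function.comp_apply]
    rw [(hg1 w hw.1 hw.2).2.2, hψl (by simpa using hw.2)]
  have hτκ : ∀ ζ : ℂ, ‖ζ‖ = 1 → τ (κ ζ) = ζ := by
    intro ζ hζ
    have := hnebot ζ hζ
    have h1 : Tendsto (fun z => ψ (Ψ z)) (𝓝[ball 0 1] ζ) (𝓝[ball 0 1] (κ ζ)) := by
      refine tendsto_nhdsWithin_iff.2 ⟨hκ ζ hζ, ?_⟩
      filter_upwards [hball ζ hζ r hC.r_lt] with z hz
      exact (hψm (hC.inner z hz.1 hz.2)).1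
    refine tendsto_nhds_unique ((hτ (κ ζ) (hκ1 ζ hζ)).comp h1) ((hid ζ).congr' ?_)
    filter_upwards [hball ζ hζ r hC.r_lt] with z hz
    simp only [Function.comp_apply]
    rw [(hψm (hC.inner z hz.1 hz.2)).2, hgl ⟨hz.1, hz.2.trans hC.lt_R⟩]
  refine ⟨τ, ⟨fun ζ hζ => ?_, fun ζ hζ ξ hξ h => ?_, fun ζ hζ => ⟨κ ζ, ?_, ?_⟩⟩, fun ζ hζ => ?_⟩
  · simpa using hτ1 ζ (by simpa using hζ)
  · rw [← hκτ ζ (by simpa using hζ), ← hκτ ξ (by simpa using hξ), h]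
  · simpa using hκ1 ζ (by simpa using hζ)
  · exact hτκ ζ (by simpa using hζ)
  · have hζ1 : ‖ζ‖ = 1 := by simpa using hζ
    have hmem : τ ζ ∈ A := sphere_subset_annulus hC.r_lt hC.lt_R (by simpa using hτ1 ζ hζ1)
    refine ((hC.continuousAt hmem).tendsto.comp (hτ ζ hζ1)).congr' ?_
    filter_upwards [hball ζ hζ1 ρ hρ1] with w hw
    exact (hg1 w hw.1 hw.2).2.2

theorem exp_ofReal_mul_I_mem_sphere (θ : ℝ) : Complex.exp (θ * Complex.I) ∈ sphere (0 : ℂ) 1 := by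
  simp [Complex.norm_exp_ofReal_mul_I]

theorem exists_exp_ofReal_mul_I_eq {ζ : ℂ} (hζ : ζ ∈ sphere (0 : ℂ) 1) :
    ∃ θ : ℝ, Complex.exp (θ * Complex.I) = ζ := by
  refine ⟨ζ.arg, ?_⟩
  have h := Complex.norm_mul_exp_arg_mul_I ζ
  rwa [mem_sphere_zero_iff_norm.1 hζ, Complex.ofReal_one, one_mul] at h

/-- The boundary values of the Riemann map are a homeomorphism from the circle onto the curve. -/
theorem exists_boundary_homeomorph {K : Set ℂ} {Ψ φ : ℂ → ℂ} {r R : ℝ}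
    (hC : IsCollar K (boundedSide K) Ψ r R) (hφ : IsRiemannMap φ (boundedSide K)) :
    trace φ = K ∧ ∃ e : sphere (0 : ℂ) 1 ≃ₜ trace φ, ∀ θ : ℝ,
      e ⟨_, exp_ofReal_mul_I_mem_sphere θ⟩ = ⟨boundaryCurve φ θ, mem_range_self θ⟩ := by
  obtain ⟨τ, hτ, hlim⟩ := exists_boundary_correspondence hC hφ
  have hcl : sphere (0 : ℂ) 1 ⊆ closure (ball 0 1) := by
    rw [closure_ball _ one_ne_zero]; exact sphere_subset_closedBall
  set f := extendFrom (ball (0 : ℂ) 1) φ with hf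
  have hfe : ∀ ζ ∈ sphere (0 : ℂ) 1, f ζ = Ψ (τ ζ) := fun ζ hζ =>
    extendFrom_eq (hcl hζ) (hlim ζ hζ)
  have hfc : ContinuousOn f (sphere 0 1) :=
    continuousOn_extendFrom hcl fun ζ hζ => ⟨_, hlim ζ hζ⟩
  have hsA := sphere_subset_annulus hC.r_lt hC.lt_R
  have hfi : InjOn f (sphere 0 1) := by
    intro ζ hζ ξ hξ h
    rw [hfe ζ hζ, hfe ξ hξ] at h
    exact hτ.injOn hζ hξ (hC.inj (hsA (hτ.mapsTo hζ)) (hsA (hτ.mapsTo hξ)) h)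
  have htr : trace φ = f '' sphere 0 1 := by
    ext p
    constructor
    · rintro ⟨θ, rfl⟩
      exact ⟨_, exp_ofReal_mul_I_mem_sphere θ, rfl⟩
    · rintro ⟨ζ, hζ, rfl⟩
      obtain ⟨θ, rfl⟩ := exists_exp_ofReal_mul_I_eq hζ
      exact ⟨θ, rfl⟩
  refine ⟨?_, ?_⟩
  · rw [htr, image_congr hfe, ← hC.circle, ← image_image Ψ τ, hτ.image_eq]
  · have hmem : ∀ ζ : sphere (0 : ℂ) 1, f ζ ∈ trace φ := fun ζ =>
      htr ▸ mem_image_of_mem f ζ.2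
    let F : sphere (0 : ℂ) 1 → trace φ := fun ζ => ⟨f ζ, hmem ζ⟩
    have hFc : Continuous F := (continuousOn_iff_continuous_domRestrict.1 hfc).subtype_mk _
    have hFb : Function.Bijective F := by
      refine ⟨fun ζ ξ h => Subtype.ext (hfi ζ.2 ξ.2 (congrArg Subtype.val h)), fun p => ?_⟩
      obtain ⟨ζ, hζ, h⟩ := (htr ▸ p.2 : (p : ℂ) ∈ f '' sphere 0 1)
      exact ⟨⟨ζ, hζ⟩, Subtype.ext h⟩
    have : CompactSpace (sphere (0 : ℂ) 1) := isCompact_iff_compactSpace.1 (isCompact_sphere 0 1)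
    exact ⟨hFc.homeoOfEquivCompactToT2 (f := Equiv.ofBijective F hFb), fun θ => rfl⟩

/-! ### Functions on an interval that extend to a half disc -/

/-- `v` extends from the interval of centre `t` and radius `a` to a function on the upper half disc
over it which is continuous up to the interval and holomorphic inside. -/
def HalfDiscExt (t a : ℝ) (v : ℝ → ℂ) : Prop :=
  ∃ G : ℂ → ℂ, ContinuousOn G (closedHalf t a) ∧ DifferentiableOn ℂ G (openHalf t a) ∧
    ∀ x : ℝ, |x - t| < a → G x = v x

/-- The same as `HalfDiscExt`, with an extension bounded by `M`. -/
def BddHalfDiscExt (t a M : ℝ) (v : ℝ → ℂ) : Prop :=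
  ∃ G : ℂ → ℂ, ContinuousOn G (closedHalf t a) ∧ DifferentiableOn ℂ G (openHalf t a) ∧
    (∀ x : ℝ, |x - t| < a → G x = v x) ∧ ∀ w ∈ closedHalf t a, ‖G w‖ ≤ M

theorem BddHalfDiscExt.halfDiscExt {t a M : ℝ} {v : ℝ → ℂ} (h : BddHalfDiscExt t a M v) :
    HalfDiscExt t a v := by
  obtain ⟨G, h1, h2, h3, -⟩ := h
  exact ⟨G, h1, h2, h3⟩

theorem HalfDiscExt.mono {t a s b : ℝ} {v : ℝ → ℂ} (h : HalfDiscExt t a v)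
    (hb : |s - t| + b ≤ a) : HalfDiscExt s b v := by
  obtain ⟨G, h1, h2, h3⟩ := h
  refine ⟨G, h1.mono (closedHalf_mono hb), h2.mono (openHalf_mono hb), fun x hx => h3 x ?_⟩
  linarith [abs_sub_le x s t]

theorem ofReal_mem_closedHalf {t a x : ℝ} (h : |x - t| < a) : (x : ℂ) ∈ closedHalf t a := by
  refine ⟨?_, by simp⟩
  rwa [mem_ball, dist_eq_norm, ← Complex.ofReal_sub, Complex.norm_real, Real.norm_eq_abs]

theorem isCompact_closedBall_inter_im (t b : ℝ) :
    IsCompact {w : ℂ | w ∈ closedBall (t : ℂ) b ∧ 0 ≤ w.im} :=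
  (isCompact_closedBall _ _).inter_right (isClosed_le continuous_const Complex.continuous_im)

theorem closedBall_inter_im_subset {t a b : ℝ} (h : b < a) :
    {w : ℂ | w ∈ closedBall (t : ℂ) b ∧ 0 ≤ w.im} ⊆ closedHalf t a :=
  fun _ hw => ⟨closedBall_subset_ball h hw.1, hw.2⟩

theorem HalfDiscExt.exists_bdd {t a b : ℝ} {v : ℝ → ℂ} (h : HalfDiscExt t a v)
    (hb : b < a) : ∃ M : ℕ, BddHalfDiscExt t b M v := by
  obtain ⟨G, h1, h2, h3⟩ := h
  obtain ⟨C, hC⟩ := (isCompact_closedBall_inter_im t b).exists_bound_of_continuousOn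
    (h1.mono (closedBall_inter_im_subset hb))
  obtain ⟨M, hM⟩ := exists_nat_ge C
  have hab : |t - t| + b ≤ a := by simpa using hb.le
  exact ⟨M, G, h1.mono (closedHalf_mono hab), h2.mono (openHalf_mono hab),
    fun x hx => h3 x (hx.trans hb), fun w hw => (hC w ⟨ball_subset_closedBall hw.1, hw.2⟩).trans hM⟩

theorem halfDiscExt_zero (t a : ℝ) : HalfDiscExt t a 0 :=
  ⟨0, continuousOn_const, differentiableOn_const 0, fun _ _ => rfl⟩

theorem HalfDiscExt.add {t a : ℝ} {v w : ℝ → ℂ} (hv : HalfDiscExt t a v)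
    (hw : HalfDiscExt t a w) : HalfDiscExt t a (v + w) := by
  obtain ⟨G, h1, h2, h3⟩ := hv
  obtain ⟨H, k1, k2, k3⟩ := hw
  exact ⟨G + H, h1.add k1, h2.add k2, fun x hx => by simp [h3 x hx, k3 x hx]⟩

theorem HalfDiscExt.const_smul {t a : ℝ} {v : ℝ → ℂ} (c : ℂ) (hv : HalfDiscExt t a v) :
    HalfDiscExt t a (c • v) := by
  obtain ⟨G, h1, h2, h3⟩ := hv
  exact ⟨c • G, h1.const_smul c, h2.const_smul c, fun x hx => by simp [h3 x hx]⟩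

/-- The functions on `α` whose composition with `p : ℝ → α` extends to a given half disc. -/
def halfDiscSubmodule {α : Type*} (p : ℝ → α) (t a : ℝ) : Submodule ℂ (α → ℂ) where
  carrier := {u | HalfDiscExt t a (u ∘ p)}
  add_mem' hu hv := hu.add hv
  zero_mem' := halfDiscExt_zero t a
  smul_mem' c _ hu := hu.const_smul c

theorem exists_exp_neg_half_lt (M : ℝ) {η : ℝ} (hη : 0 < η) :
    ∃ N : ℝ, 0 ≤ N ∧ M * Real.exp (-(N / 2)) < η := by
  have h1 : Tendsto (fun N : ℝ => M * Real.exp (-(N / 2))) atTop (𝓝 (M * 0)) :=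
    (Real.tendsto_exp_neg_atTop_nhds_zero.comp
      (tendsto_id.atTop_div_const (by norm_num : (0 : ℝ) < 2))).const_mul M
  rw [mul_zero] at h1
  obtain ⟨N, hN, hN0⟩ := ((h1.eventually_lt_const hη).and (eventually_ge_atTop 0)).exists
  exact ⟨N, hN0, hN⟩

theorem exp_half_mul_exp_neg (N : ℝ) : Real.exp (N / 2) * Real.exp (-N) = Real.exp (-(N / 2)) := by
  rw [← Real.exp_add]; congr 1; ring

/-- A uniform limit of functions with uniformly bounded extensions to a half disc extends to a
smaller half disc. -/
theorem halfDiscExt_of_forall_approx {t a M : ℝ} (ha : 0 < a) {v : ℝ → ℂ}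
    (h : ∀ ε > 0, ∃ v', BddHalfDiscExt t a M v' ∧ ∀ x, ‖v x - v' x‖ ≤ ε) :
    HalfDiscExt t (a / 10) v := by
  have hpos : ∀ n : ℕ, (0 : ℝ) < 1 / (n + 1) := fun n => Nat.one_div_pos_of_nat
  choose v' hv' hvv' using fun n : ℕ => h (1 / (n + 1)) (hpos n)
  choose G hGc hGd hGv hGM using hv'
  have hsub : closedHalf t (a / 10) ⊆ closedHalf t a := closedHalf_mono (by simp; linarith)
  have hosub : openHalf t (a / 10) ⊆ openHalf t a := openHalf_mono (by simp; linarith)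
  have hcau : UniformCauchySeqOn G atTop (closedHalf t (a / 10)) := by
    rw [Metric.uniformCauchySeqOn_iff]
    intro η hη
    -- First `N`, to beat the bound `2M` on the arc; then `n₀`, depending on `N`, to beat `exp (N /
    -- 2)` on the diameter.
    obtain ⟨N, hN0, hN⟩ := exists_exp_neg_half_lt (M + M) hη
    obtain ⟨n₀, hn₀⟩ := exists_nat_one_div_lt
      (show 0 < η / (2 * Real.exp (N / 2)) by positivity)
    refine ⟨n₀, fun m hm n hn w hw => ?_⟩
    have hmono : ∀ k ≥ n₀, ∀ x : ℝ, ‖v x - v' k x‖ ≤ 1 / ((n₀ : ℝ) + 1) := fun k hk x =>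
      (hvv' k x).trans (Nat.one_div_le_one_div hk)
    have hlt : a / 2 < a := by linarith
    -- Radius `a / 2` keeps the closed half disc inside the domain; the estimate divides it by `5`,
    -- whence `a / 10`.
    have key := two_constants_half (G := G m - G n) (t := t) (b := a / 2)
      (ε := 2 * (1 / ((n₀ : ℝ) + 1))) (M := M + M) (N := N) (w := w) (by positivity)
      (((hGc m).sub (hGc n)).mono (closedBall_inter_im_subset hlt))
      (((hGd m).sub (hGd n)).mono (openHalf_mono (by simp; linarith))) hN0
      (fun x hx => by
        have hx' : |x - t| < a := hx.trans_lt hlt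
        rw [Pi.sub_apply, hGv m x hx', hGv n x hx',
          show v' m x - v' n x = (v x - v' n x) - (v x - v' m x) by ring]
        linarith [norm_sub_le (v x - v' n x) (v x - v' m x), hmono m hm x, hmono n hn x])
      (fun z hz hz0 => (norm_sub_le _ _).trans
        (add_le_add (hGM m z ⟨closedBall_subset_ball hlt hz, hz0⟩)
          (hGM n z ⟨closedBall_subset_ball hlt hz, hz0⟩)))
      (by rwa [show a / 2 / 5 = a / 10 by ring])
    rw [dist_eq_norm]
    refine key.trans_lt ?_
    rw [mul_max_of_nonneg _ _ (Real.exp_pos _).le, max_lt_iff]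
    constructor
    · rw [lt_div_iff₀ (by positivity)] at hn₀
      linarith
    · rw [mul_left_comm, exp_half_mul_exp_neg]
      exact hN
  have hlim : ∀ w ∈ closedHalf t (a / 10), ∃ l, Tendsto (fun n => G n w) atTop (𝓝 l) :=
    fun w hw => cauchySeq_tendsto_of_complete (hcau.cauchySeq hw)
  choose! F hF using hlim
  have hunif : TendstoUniformlyOn G F atTop (closedHalf t (a / 10)) :=
    hcau.tendstoUniformlyOn_of_tendsto fun w hw => hF w hw
  refine ⟨F, hunif.continuousOn (Frequently.of_forall fun n => (hGc n).mono hsub), ?_, ?_⟩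
  · exact (hunif.mono (openHalf_subset t _)).tendstoLocallyUniformlyOn.differentiableOn
      (Eventually.of_forall fun n => (hGd n).mono hosub) (isOpen_openHalf t _)
  · intro x hx
    refine tendsto_nhds_unique (hF x (ofReal_mem_closedHalf hx)) ?_
    have h1 : Tendsto (fun n => v' n x) atTop (𝓝 (v x)) := by
      rw [tendsto_iff_norm_sub_tendsto_zero]
      refine squeeze_zero (fun _ => norm_nonneg _) (fun n => ?_) tendsto_one_div_add_atTop_nhds_zero_nat
      rw [norm_sub_rev]
      exact hvv' n x
    refine h1.congr fun n => (hGv n x (by linarith)).symm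

/-- A boundary uniqueness theorem: boundary values which vanish near one point of the interval
vanish at its centre. -/
theorem HalfDiscExt.eq_zero {t a s : ℝ} {v : ℝ → ℂ} (h : HalfDiscExt t a v)
    (hs : |s - t| < a) (hv : ∀ᶠ x in 𝓝 s, v x = 0) : v t = 0 := by
  obtain ⟨G, hGc, hGd, hGv⟩ := h
  obtain ⟨δ₀, hδ₀, hδv⟩ := Metric.eventually_nhds_iff.1 hv
  set δ := min δ₀ (a - |s - t|) with hδ
  have hδ0 : 0 < δ := lt_min hδ₀ (by linarith)
  have hδa : |s - t| + δ ≤ a := by linarith [min_le_right δ₀ (a - |s - t|)]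
  have hlt : δ / 2 < δ := by linarith
  obtain ⟨M, hM⟩ := (isCompact_closedBall_inter_im s (δ / 2)).exists_bound_of_continuousOn
    (hGc.mono ((closedBall_inter_im_subset hlt).trans (closedHalf_mono hδa)))
  -- Two constants with `ε = 0` and `N → ∞`. The identity theorem then spreads the zero over the
  -- whole half disc, and continuity carries it to `t`.
  have hzero : ∀ w ∈ closedHalf s (δ / 2 / 5), G w = 0 := by
    intro w hw
    rw [← norm_le_zero_iff]
    refine le_of_forall_pos_lt_add fun η hη => ?_
    obtain ⟨N, hN0, hN⟩ := exists_exp_neg_half_lt M hη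
    have key := two_constants_half (G := G) (t := s) (b := δ / 2) (ε := 0) (M := M) (N := N)
      (by positivity)
      (hGc.mono ((closedBall_inter_im_subset hlt).trans (closedHalf_mono hδa)))
      (hGd.mono (openHalf_mono (by linarith))) hN0
      (fun x hx => by
        have hxδ : |x - s| < δ := hx.trans_lt hlt
        rw [hGv x (by linarith [abs_sub_le x s t]),
          hδv (by rw [Real.dist_eq]; exact hxδ.trans_le (min_le_left _ _)), norm_zero])
      (fun z hz hz0 => hM z ⟨hz, hz0⟩) hw
    refine key.trans_lt ?_
    rw [zero_add, mul_max_of_nonneg _ _ (Real.exp_pos _).le, max_lt_iff]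
    constructor
    · simpa using hη
    · rw [mul_left_comm, exp_half_mul_exp_neg]
      exact hN
  have hEq : EqOn G 0 (openHalf t a) := by
    have hz0 : (s : ℂ) + (δ / 20 : ℝ) * Complex.I ∈ openHalf s (δ / 2 / 5) := by
      constructor
      · rw [mem_ball, dist_eq_norm, add_sub_cancel_left, norm_mul, Complex.norm_real,
          Real.norm_eq_abs, abs_of_pos (by positivity), Complex.norm_I]
        linarith
      · simp; linarith
    refine (hGd.analyticOnNhd (isOpen_openHalf t a)).eqOn_zero_of_preconnected_of_eventuallyEq_zero
      (convex_openHalf t a).isPreconnected (openHalf_mono (by linarith) hz0) ?_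
    filter_upwards [(isOpen_openHalf _ _).mem_nhds hz0] with w hw
    exact hzero w (openHalf_subset _ _ hw)
  have ha : 0 < a := (abs_nonneg _).trans_lt hs
  have hta : |t - t| < a := by simpa using ha
  have htc := ofReal_mem_closedHalf hta
  have hnb : (𝓝[openHalf t a] (t : ℂ)).NeBot :=
    mem_closure_iff_nhdsWithin_neBot.1 (closedHalf_subset_closure t a htc)
  rw [← hGv t hta]
  refine tendsto_nhds_unique ((hGc t htc).mono (openHalf_subset t a)) ?_
  refine tendsto_const_nhds.congr' ?_
  filter_upwards [self_mem_nhdsWithin] with w hw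
  exact (hEq hw).symm

/-! ### Extension into a side of the curve in terms of half discs -/

namespace IsCollar

variable {K S : Set ℂ} {Ψ : ℂ → ℂ} {r R : ℝ}

/-- The parametrization of the curve given by a collar. -/
noncomputable def param (h : IsCollar K S Ψ r R) (t : ℝ) : K :=
  ⟨Ψ (Complex.exp (t * Complex.I)), h.map_mem (Complex.norm_exp_ofReal_mul_I t)⟩

theorem norm_exp_mul_I (w : ℂ) : ‖Complex.exp (w * Complex.I)‖ = Real.exp (-w.im) := by
  simp [Complex.norm_exp]

theorem exp_mem_annulus (h : IsCollar K S Ψ r R) (t : ℝ) :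
    Complex.exp (t * Complex.I) ∈ annulus r R :=
  sphere_subset_annulus h.r_lt h.lt_R (exp_ofReal_mul_I_mem_sphere t)

theorem continuous_param (h : IsCollar K S Ψ r R) : Continuous h.param := by
  refine Continuous.subtype_mk ?_ _
  exact h.diff.continuousOn.comp_continuous (by fun_prop) h.exp_mem_annulus

theorem exists_param_eq (h : IsCollar K S Ψ r R) {z : ℂ} (hz : z ∈ K) :
    ∃ t : ℝ, (h.param t : ℂ) = z := by
  rw [← h.circle] at hz
  obtain ⟨ζ, hζ, rfl⟩ := hz
  obtain ⟨t, rfl⟩ := exists_exp_ofReal_mul_I_eq hζ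
  exact ⟨t, rfl⟩

theorem eventually_exp_mem_annulus (h : IsCollar K S Ψ r R) (t : ℝ) :
    ∀ᶠ w in 𝓝 (t : ℂ), Complex.exp (w * Complex.I) ∈ annulus r R :=
  (by fun_prop : Continuous fun w : ℂ => Complex.exp (w * Complex.I)).continuousAt.eventually
    ((isOpen_annulus r R).mem_nhds (h.exp_mem_annulus t))

theorem mem_of_im_pos (h : IsCollar K S Ψ r R) {w : ℂ}
    (hw : Complex.exp (w * Complex.I) ∈ annulus r R) (him : 0 < w.im) :
    Ψ (Complex.exp (w * Complex.I)) ∈ S :=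
  h.inner _ hw.1 (by rw [norm_exp_mul_I, Real.exp_lt_one_iff]; linarith)

theorem im_pos_of_mem (h : IsCollar K S Ψ r R) {w : ℂ}
    (hw : Complex.exp (w * Complex.I) ∈ annulus r R)
    (hS : Ψ (Complex.exp (w * Complex.I)) ∈ S) : 0 < w.im := by
  have := h.norm_lt_one_of_mem hw hS
  rw [norm_exp_mul_I, Real.exp_lt_one_iff] at this
  linarith

theorem im_eq_zero_of_mem (h : IsCollar K S Ψ r R) {w : ℂ}
    (hw : Complex.exp (w * Complex.I) ∈ annulus r R)
    (hK : Ψ (Complex.exp (w * Complex.I)) ∈ K) : w.im = 0 := by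
  rw [← h.circle] at hK
  obtain ⟨ζ, hζ, h1⟩ := hK
  have h2 := h.inj (sphere_subset_annulus h.r_lt h.lt_R hζ) hw h1
  have h3 : ‖ζ‖ = 1 := by simpa using hζ
  rw [h2, norm_exp_mul_I, Real.exp_eq_one_iff] at h3
  linarith

theorem differentiableOn_comp_exp (h : IsCollar K S Ψ r R) {B : Set ℂ}
    (hB : ∀ w ∈ B, Complex.exp (w * Complex.I) ∈ annulus r R) :
    DifferentiableOn ℂ (fun w => Ψ (Complex.exp (w * Complex.I))) B :=
  h.diff.comp (by fun_prop : Differentiable ℂ fun w : ℂ => Complex.exp (w * Complex.I)).differentiableOn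
    hB

theorem exists_halfDiscExt (h : IsCollar K S Ψ r R) {u : K → ℂ} {t : ℝ}
    (hu : ExtendsAt K S u (h.param t)) : ∃ a > 0, HalfDiscExt t a (u ∘ h.param) := by
  obtain ⟨ρ, hρ, F, hFc, hFd, hFu⟩ := hu
  set E : ℂ → ℂ := fun w => Ψ (Complex.exp (w * Complex.I)) with hE
  have hcont : ContinuousAt E t :=
    (h.continuousAt (h.exp_mem_annulus t)).comp (f := fun w : ℂ => Complex.exp (w * Complex.I))
      (by fun_prop)
  obtain ⟨a, ha, hball⟩ := Metric.eventually_nhds_iff_ball.1 ((h.eventually_exp_mem_annulus t).and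
    (hcont.eventually (ball_mem_nhds _ hρ)))
  have hEd : DifferentiableOn ℂ E (ball (t : ℂ) a) :=
    h.differentiableOn_comp_exp fun w hw => (hball w hw).1
  refine ⟨a, ha, F ∘ E, ?_, ?_, fun x hx => ?_⟩
  · refine hFc.comp (hEd.continuousOn.mono fun w hw => hw.1) fun w hw => ?_
    rcases hw.2.eq_or_lt with him | him
    · refine Or.inl (h.map_mem ?_)
      rw [norm_exp_mul_I, ← him]; simp
    · exact Or.inr ⟨(hball w hw.1).2, h.mem_of_im_pos (hball w hw.1).1 him⟩
  · exact hFd.comp (hEd.mono fun w hw => hw.1) fun w hw =>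
      ⟨(hball w hw.1).2, h.mem_of_im_pos (hball w hw.1).1 hw.2⟩
  · exact hFu (h.param x) (hball x (ofReal_mem_closedHalf hx).1).2

/-- The only ambiguity is the period `2π`; `2` is a convenient smaller bound, matching discs of
radius at most `1`. -/
theorem eq_of_comp_exp_eq (h : IsCollar K S Ψ r R) {w z : ℂ}
    (hw : Complex.exp (w * Complex.I) ∈ annulus r R)
    (hz : Complex.exp (z * Complex.I) ∈ annulus r R) (h2 : ‖w - z‖ < 2)
    (hwz : Ψ (Complex.exp (w * Complex.I)) = Ψ (Complex.exp (z * Complex.I))) : w = z := by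
  obtain ⟨n, hn⟩ := Complex.exp_eq_exp_iff_exists_int.1 (h.inj hw hz hwz)
  have h1 : w - z = n * (2 * Real.pi) := by
    have : (w - z) * Complex.I = (n * (2 * Real.pi)) * Complex.I := by
      linear_combination hn
    exact mul_right_cancel₀ Complex.I_ne_zero this
  have h3 : ‖w - z‖ = |(n : ℝ)| * (2 * Real.pi) := by
    rw [h1, norm_mul, Complex.norm_intCast, norm_mul, Complex.norm_real, Real.norm_eq_abs,
      abs_of_pos Real.pi_pos]
    simp
  have h4 : n = 0 := by
    by_contra hn0
    have h5 : (1 : ℝ) ≤ |(n : ℝ)| := by exact_mod_cast Int.one_le_abs hn0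
    nlinarith [Real.pi_gt_three]
  rw [h4, Int.cast_zero, zero_mul, sub_eq_zero] at h1
  exact h1

theorem injOn_comp_exp (h : IsCollar K S Ψ r R) {t a : ℝ} (ha : a ≤ 1)
    (hB : ∀ w ∈ ball (t : ℂ) a, Complex.exp (w * Complex.I) ∈ annulus r R) :
    InjOn (fun w => Ψ (Complex.exp (w * Complex.I))) (ball (t : ℂ) a) := by
  intro w hw z hz hwz
  refine h.eq_of_comp_exp_eq (hB w hw) (hB z hz) ?_ hwz
  rw [← dist_eq_norm]
  have := dist_triangle_right w z (t : ℂ)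
  rw [mem_ball] at hw hz
  linarith

/-- The half-disc extension is carried back by the local inverse of `w ↦ Ψ (exp (i w))` and glued to
`u` on the rest of `K`, where continuity is also demanded. -/
theorem extendsAt_of_halfDiscExt (h : IsCollar K S Ψ r R) {u : K → ℂ} (huc : Continuous u)
    {t a : ℝ} (ha : 0 < a) (hu : HalfDiscExt t a (u ∘ h.param)) :
    ExtendsAt K S u (h.param t) := by
  classical
  obtain ⟨a₁, ha₁, hball₁⟩ := Metric.eventually_nhds_iff_ball.1 (h.eventually_exp_mem_annulus t)
  set b := min a (min a₁ 1) with hb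
  have hb0 : 0 < b := lt_min ha (lt_min ha₁ one_pos)
  have hb1 : b ≤ 1 := (min_le_right _ _).trans (min_le_right _ _)
  have hba : |t - t| + b ≤ a := by
    rw [sub_self, abs_zero, zero_add]
    exact min_le_left _ _
  have hbA : ∀ w ∈ ball (t : ℂ) b, Complex.exp (w * Complex.I) ∈ annulus r R := fun w hw =>
    hball₁ w (ball_subset_ball ((min_le_right _ _).trans (min_le_left _ _)) hw)
  obtain ⟨G, hGc, hGd, hGu⟩ := hu.mono hba
  set E : ℂ → ℂ := fun w => Ψ (Complex.exp (w * Complex.I)) with hE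
  have hEd : DifferentiableOn ℂ E (ball (t : ℂ) b) := h.differentiableOn_comp_exp hbA
  have hEi : InjOn E (ball (t : ℂ) b) := h.injOn_comp_exp hb1 hbA
  set g := Function.invFunOn E (ball (t : ℂ) b) with hg
  have hgd : DifferentiableOn ℂ g (E '' ball (t : ℂ) b) :=
    differentiableOn_invFunOn isOpen_ball hEd hEi
  have hNo : IsOpen (E '' ball (t : ℂ) b) :=
    isOpen_image_of_injOn isOpen_ball hEd hEi isOpen_ball subset_rfl
  obtain ⟨ρ, hρ, hρN⟩ := Metric.isOpen_iff.1 hNo (E t) (mem_image_of_mem E (mem_ball_self hb0))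
  have hgm : ∀ z ∈ ball (E t) ρ, g z ∈ ball (t : ℂ) b ∧ E (g z) = z := fun z hz =>
    ⟨Function.invFunOn_mem (hρN hz), Function.invFunOn_eq (hρN hz)⟩
  have hgK : ∀ z ∈ ball (E t) ρ, z ∈ K → (g z).im = 0 := fun z hz hzK =>
    h.im_eq_zero_of_mem (hbA _ (hgm z hz).1) (by
      have := (hgm z hz).2
      simp only [hE] at this
      rwa [this])
  have hgS : ∀ z ∈ ball (E t) ρ, z ∈ S → 0 < (g z).im := fun z hz hzS =>
    h.im_pos_of_mem (hbA _ (hgm z hz).1) (by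
      have := (hgm z hz).2
      simp only [hE] at this
      rwa [this])
  let v : ℂ → ℂ := fun z => if hz : z ∈ K then u ⟨z, hz⟩ else 0
  have hv : ∀ z : K, v z = u z := fun z => dif_pos z.2
  have hvc : ContinuousOn v K := by
    rw [continuousOn_iff_continuous_domRestrict]
    exact huc.congr fun z => (hv z).symm
  let F : ℂ → ℂ := fun z => if z ∈ ball (E t) ρ then G (g z) else v z
  have hF1 : ∀ z ∈ ball (E t) ρ, F z = G (g z) := fun z hz => if_pos hz
  have hFK : ∀ z ∈ K, F z = v z := by
    intro z hz
    by_cases hzb : z ∈ ball (E t) ρ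
    · rw [hF1 z hzb]
      have him := hgK z hzb hz
      have hgz : g z = ((g z).re : ℂ) := Complex.ext rfl (by simpa using him)
      have hlt : |(g z).re - t| < b := by
        have := (hgm z hzb).1
        rwa [hgz, mem_ball, dist_eq_norm, ← Complex.ofReal_sub, Complex.norm_real,
          Real.norm_eq_abs] at this
      rw [hgz, hGu _ hlt, hv ⟨z, hz⟩, Function.comp_apply]
      congr 1
      refine Subtype.ext ?_
      change E ((g z).re : ℂ) = z
      rw [← hgz, (hgm z hzb).2]
    · exact if_neg hzb
  -- Halving the radius separates the two formulas: near a point outside the `ρ`-disc the domain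
  -- consists of points of `K` only.
  have hρ2 : ball (E t) (ρ / 2) ⊆ ball (E t) ρ := ball_subset_ball (by linarith)
  refine ⟨ρ / 2, by positivity, F, ?_, ?_, fun z _ => (hFK z z.2).trans (hv z)⟩
  · change ContinuousOn F (K ∪ (ball (E t) (ρ / 2) ∩ S))
    intro z hz
    by_cases hzb : z ∈ ball (E t) ρ
    · have hnb : ball (E t) ρ ∈ 𝓝 z := isOpen_ball.mem_nhds hzb
      have hmaps : MapsTo g ((K ∪ (ball (E t) (ρ / 2) ∩ S)) ∩ ball (E t) ρ) (closedHalf t b) := by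
        rintro p ⟨hp, hpb⟩
        refine ⟨(hgm p hpb).1, ?_⟩
        rcases hp with hp | hp
        · exact (hgK p hpb hp).ge
        · exact (hgS p hpb hp.2).le
      rw [← continuousWithinAt_inter hnb]
      refine ContinuousWithinAt.congr (f := G ∘ g) ?_ (fun p hp => hF1 p hp.2) (hF1 z hzb)
      refine (hGc (g z) (hmaps ⟨hz, hzb⟩)).comp ?_ hmaps
      exact (hgd.continuousOn.continuousAt (hNo.mem_nhds (hρN hzb))).continuousWithinAt
    · have hzK : z ∈ K := hz.resolve_right fun h' => hzb (hρ2 h'.1)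
      have hnb : (closedBall (E t) (ρ / 2))ᶜ ∈ 𝓝 z :=
        isClosed_closedBall.isOpen_compl.mem_nhds fun h' =>
          hzb (closedBall_subset_ball (by linarith) h')
      rw [← continuousWithinAt_inter hnb]
      have hsub : (K ∪ (ball (E t) (ρ / 2) ∩ S)) ∩ (closedBall (E t) (ρ / 2))ᶜ ⊆ K := by
        rintro p ⟨hp | hp, hpb⟩
        · exact hp
        · exact absurd (ball_subset_closedBall hp.1) hpb
      exact ((hvc z hzK).mono hsub).congr (fun p hp => hFK p (hsub hp)) (hFK z hzK)
  · change DifferentiableOn ℂ F (ball (E t) (ρ / 2) ∩ S)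
    refine DifferentiableOn.congr (f := G ∘ g) ?_ fun p hp => hF1 p (hρ2 hp.1)
    exact hGd.comp (hgd.mono fun p hp => hρN (hρ2 hp.1)) fun p hp =>
      ⟨(hgm p (hρ2 hp.1)).1, hgS p (hρ2 hp.1) hp.2⟩

end IsCollar

open scoped ContDiff

/-! ### Smooth functions that extend nowhere -/

/-- Controlling only orders up to `n` in the `n`-th term is enough for a series with bounded
coefficients to be smooth. -/
theorem exists_small_multiple {g : ℂ → ℂ} (hg : ContDiff ℝ ∞ g) (hs : HasCompactSupport g)
    (n : ℕ) : ∃ c : ℝ, 0 < c ∧ ∀ l ≤ n, ∀ z, ‖iteratedFDeriv ℝ l (c • g) z‖ ≤ (1 / 2) ^ n := by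
  have hb : ∀ l : ℕ, ∃ C, ∀ z, ‖iteratedFDeriv ℝ l g z‖ ≤ C := fun l =>
    (hs.iteratedFDeriv l).exists_bound_of_continuous
      (hg.continuous_iteratedFDeriv (by exact_mod_cast le_top))
  choose C hC using hb
  have hC0 : ∀ l, 0 ≤ C l := fun l => (norm_nonneg _).trans (hC l 0)
  set D := 1 + ∑ l ∈ Finset.range (n + 1), C l with hD
  have hD0 : 0 < D := by
    have := Finset.sum_nonneg fun l (_ : l ∈ Finset.range (n + 1)) => hC0 l
    linarith
  refine ⟨(1 / 2) ^ n / D, by positivity, fun l hl z => ?_⟩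
  have hgl : ContDiffAt ℝ l g z := (hg.of_le (by exact_mod_cast le_top)).contDiffAt
  rw [iteratedFDeriv_const_smul_apply hgl, norm_smul, Real.norm_of_nonneg (by positivity),
    div_mul_eq_mul_div, div_le_iff₀ hD0]
  gcongr
  have := Finset.single_le_sum (fun l (_ : l ∈ Finset.range (n + 1)) => hC0 l)
    (Finset.mem_range.2 (Nat.lt_succ_of_le hl))
  linarith [hC l z]

theorem summable_mul_of_le_geometric {x g : ℕ → ℂ} {C : ℝ} (hx : ∀ n, ‖x n‖ ≤ C)
    (hg : ∀ n, ‖g n‖ ≤ (1 / 2) ^ n) : Summable fun n => x n * g n := by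
  refine Summable.of_norm_bounded (summable_geometric_two.mul_left C) fun n => ?_
  rw [norm_mul]
  exact mul_le_mul (hx n) (hg n) (norm_nonneg _) ((norm_nonneg _).trans (hx n))

open scoped BoundedContinuousFunction in
/-- A Baire category argument in the space of bounded sequences of coefficients. -/
theorem exists_tsum_notMem {α ι : Type*} [Countable ι] (f : ℕ → α → ℂ)
    (hf : ∀ n x, ‖f n x‖ ≤ (1 / 2) ^ n) (P : ι → Set (α → ℂ)) (Q : ι → Submodule ℂ (α → ℂ))
    (hPQ : ∀ i u, (∀ ε > 0, ∃ u' ∈ P i, ∀ x, ‖u x - u' x‖ ≤ ε) → u ∈ Q i)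
    (hfQ : ∀ i, ∃ n, f n ∉ Q i) :
    ∃ x : ℕ →ᵇ ℂ, ∀ i, (fun a => ∑' n, x n * f n a) ∉ P i := by
  by_contra! hcon
  set T : (ℕ →ᵇ ℂ) → α → ℂ := fun x a => ∑' n, x n * f n a with hT
  have hsum : ∀ (x : ℕ →ᵇ ℂ) a, Summable fun n => x n * f n a := fun x a =>
    summable_mul_of_le_geometric (fun n => x.norm_coe_le_norm n) fun n => hf n a
  have hTsub : ∀ x y a, ‖T x a - T y a‖ ≤ ‖x - y‖ * 2 := by
    intro x y a
    simp only [hT]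
    rw [← (hsum x a).tsum_sub (hsum y a)]
    refine tsum_of_norm_bounded (hasSum_geometric_two.mul_left ‖x - y‖) fun n => ?_
    rw [← sub_mul, norm_mul]
    exact mul_le_mul ((x - y).norm_coe_le_norm n) (hf n a) (norm_nonneg _) (norm_nonneg _)
  -- `T` is Lipschitz from the sup norm on coefficients to the sup norm on functions, so closures
  -- turn into uniform limits.
  have hclos : ∀ i, ∀ y ∈ closure {x | T x ∈ P i}, T y ∈ Q i := by
    intro i y hy
    refine hPQ i _ fun ε hε => ?_
    obtain ⟨x, hx, hxy⟩ := Metric.mem_closure_iff.1 hy (ε / 2) (by positivity)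
    refine ⟨T x, hx, fun a => (hTsub y x a).trans ?_⟩
    rw [dist_eq_norm] at hxy
    linarith
  obtain ⟨i, x, hx⟩ := nonempty_interior_of_iUnion_of_closed
    (f := fun i => closure {x | T x ∈ P i}) (fun i => isClosed_closure) (by
      refine eq_univ_of_forall fun x => ?_
      obtain ⟨i, hi⟩ := hcon x
      exact mem_iUnion.2 ⟨i, subset_closure hi⟩)
  obtain ⟨n, hn⟩ := hfQ i
  let e : ℕ →ᵇ ℂ := BoundedContinuousFunction.ofNormedAddCommGroupDiscrete
    (Pi.single n (1 : ℂ)) 1 fun m => by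
      by_cases h : m = n
      · subst h; simp
      · simp [Pi.single_eq_of_ne h]
  have hcont : Tendsto (fun s : ℝ => x + (s : ℂ) • e) (𝓝[>] 0) (𝓝 x) := by
    have hc : Continuous fun s : ℝ => x + (s : ℂ) • e :=
      continuous_const.add (Complex.continuous_ofReal.smul continuous_const)
    have h := hc.tendsto 0
    simp only [Complex.ofReal_zero, zero_smul, add_zero] at h
    exact h.mono_left nhdsWithin_le_nhds
  obtain ⟨s, hs, hs0⟩ := ((hcont.eventually (isOpen_interior.mem_nhds hx)).and
    (self_mem_nhdsWithin (s := Ioi (0 : ℝ)))).exists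
  -- Moving the `n`-th coefficient inside the interior puts the multiple `s • f n` in the subspace
  -- `Q i`, contrary to the choice of `n`.
  have h1 : T (x + (s : ℂ) • e) ∈ Q i := hclos i _ (interior_subset hs)
  have h2 : T x ∈ Q i := hclos i _ (interior_subset hx)
  have h3 : T (x + (s : ℂ) • e) - T x = (s : ℂ) • f n := by
    funext a
    simp only [hT, Pi.sub_apply, Pi.smul_apply, smul_eq_mul]
    rw [← (hsum _ a).tsum_sub (hsum x a), tsum_eq_single n]
    · simp [e]; ring
    · intro m hm
      simp [e, Pi.single_eq_of_ne hm]
  have h4 := (Q i).sub_mem h1 h2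
  rw [h3] at h4
  refine hn (((Q i).smul_mem_iff ?_).1 h4)
  exact_mod_cast (ne_of_gt hs0)

theorem contDiff_tsum_coeff {g : ℕ → ℂ → ℂ} (hg : ∀ n, ContDiff ℝ ∞ (g n))
    (hgb : ∀ n, ∀ l ≤ n, ∀ z, ‖iteratedFDeriv ℝ l (g n) z‖ ≤ (1 / 2) ^ n) {x : ℕ → ℂ} {C : ℝ}
    (hx : ∀ n, ‖x n‖ ≤ C) : ContDiff ℝ ∞ fun z => ∑' n, x n * g n z := by
  have hC : 0 ≤ C := (norm_nonneg _).trans (hx 0)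
  refine contDiff_tsum_of_eventually (N := ⊤) (v := fun _ n => C * (1 / 2) ^ n)
    (fun n => contDiff_const.mul (hg n)) (fun k _ => summable_geometric_two.mul_left C)
    fun k _ => ?_
  rw [Nat.cofinite_eq_atTop]
  filter_upwards [eventually_ge_atTop k] with n hn z
  have hgl : ContDiffAt ℝ k (g n) z := ((hg n).of_le (by exact_mod_cast le_top)).contDiffAt
  change ‖iteratedFDeriv ℝ k (x n • g n) z‖ ≤ _
  rw [iteratedFDeriv_const_smul_apply hgl, norm_smul]
  exact mul_le_mul (hx n) (hgb n k hn z) (norm_nonneg _) hC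

namespace IsCollar

variable {K S : Set ℂ} {Ψ : ℂ → ℂ} {r R : ℝ}

theorem param_ne (h : IsCollar K S Ψ r R) {s t : ℝ} (hne : s ≠ t) (hlt : |s - t| < 2) :
    h.param s ≠ h.param t := by
  intro heq
  have := h.eq_of_comp_exp_eq (h.exp_mem_annulus s) (h.exp_mem_annulus t)
    (by rwa [← Complex.ofReal_sub, Complex.norm_real]) (congrArg Subtype.val heq)
  exact hne (Complex.ofReal_injective this)

/-- The functions with an extension bounded by `i.2.2` to the half disc of rational centre `i.1` and
radius `1 / (i.2.1 + 1)`. -/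
def bddClass (h : IsCollar K S Ψ r R) (i : ℚ × ℕ × ℕ) : Set (K → ℂ) :=
  {u | BddHalfDiscExt i.1 (1 / ((i.2.1 : ℝ) + 1)) i.2.2 (u ∘ h.param)}

/-- Reduction to countably many classes: a half disc of radius `a / 2` about a nearby rational fits
in the given one, and compactness bounds the extension on a smaller one. -/
theorem exists_mem_bddClass (h : IsCollar K S Ψ r R) {u : K → ℂ} {z₀ : ℂ} (hz₀ : z₀ ∈ K)
    (hu : ExtendsAt K S u z₀) : ∃ i, u ∈ h.bddClass i := by
  obtain ⟨t, rfl⟩ := h.exists_param_eq hz₀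
  obtain ⟨a, ha, hext⟩ := h.exists_halfDiscExt hu
  obtain ⟨q, hq1, hq2⟩ := exists_rat_btwn (show t < t + a / 2 by linarith)
  obtain ⟨n, hn⟩ := exists_nat_one_div_lt (show 0 < a / 2 by linarith)
  have hq : |(q : ℝ) - t| + a / 2 ≤ a := by
    rw [abs_of_pos (by linarith)]; linarith
  obtain ⟨M, hM⟩ := (hext.mono hq).exists_bdd hn
  exact ⟨(q, n, M), hM⟩

theorem extendsAt_of_mem_halfDiscSubmodule (h : IsCollar K S Ψ r R) {u : K → ℂ}
    (huc : Continuous u) {t a : ℝ} (ha : 0 < a) (hu : u ∈ halfDiscSubmodule h.param t a) :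
    ∃ z₀ ∈ K, ExtendsAt K S u z₀ :=
  ⟨h.param t, (h.param t).2, h.extendsAt_of_halfDiscExt huc ha hu⟩

theorem mem_halfDiscSubmodule_of_approx (h : IsCollar K S Ψ r R) {i : ℚ × ℕ × ℕ} {u : K → ℂ}
    (hu : ∀ ε > 0, ∃ u' ∈ h.bddClass i, ∀ x, ‖u x - u' x‖ ≤ ε) :
    u ∈ halfDiscSubmodule h.param i.1 (1 / ((i.2.1 : ℝ) + 1) / 10) := by
  refine halfDiscExt_of_forall_approx (M := i.2.2) Nat.one_div_pos_of_nat fun ε hε => ?_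
  obtain ⟨u', hu', hd⟩ := hu ε hε
  exact ⟨_, hu', fun x => hd _⟩

/-- The bump is `1` at the circle point over `t` and vanishes near the one over `t + b`, which
boundary uniqueness forbids for an extendable function. It lives on the plane and is moved to the
curve by `e`, because smoothness is measured on the circle. -/
theorem exists_bump (h : IsCollar K S Ψ r R) (e : sphere (0 : ℂ) 1 ≃ₜ K) (t : ℝ) {a : ℝ}
    (ha : 0 < a) : ∃ g : ℂ → ℂ, ContDiff ℝ ∞ g ∧ HasCompactSupport g ∧
      ∀ c : ℝ, c ≠ 0 → (fun p => (c • g) (e.symm p)) ∉ halfDiscSubmodule h.param t a := by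
  -- `b < a` keeps `t + b` in the interval; `b < 1` makes the two points of the curve distinct.
  set b := min a 1 / 2 with hb
  have hb0 : 0 < b := half_pos (lt_min ha one_pos)
  have hba : b < a := by linarith [min_le_left a 1, lt_min ha one_pos]
  have hb1 : b < 1 := by linarith [min_le_right a 1, lt_min ha one_pos]
  have hst : |(t + b) - t| = b := by rw [add_sub_cancel_left, abs_of_pos hb0]
  have hne : h.param (t + b) ≠ h.param t := h.param_ne (by linarith) (by rw [hst]; linarith)
  set ζ := e.symm (h.param t) with hζ
  set ξ := e.symm (h.param (t + b)) with hξ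
  have hd : 0 < dist (ξ : ℂ) ζ := dist_pos.2 fun heq =>
    hne (e.symm.injective (Subtype.ext heq))
  let B : ContDiffBump (ζ : ℂ) := ⟨dist (ξ : ℂ) ζ / 4, dist (ξ : ℂ) ζ / 2, by positivity,
    by linarith⟩
  refine ⟨fun z => ((B z : ℝ) : ℂ), Complex.ofRealCLM.contDiff.comp B.contDiff,
    B.hasCompactSupport.comp_left Complex.ofReal_zero, fun c hc hmem => ?_⟩
  have hext : HalfDiscExt t a
    ((fun p => (c • fun z => ((B z : ℝ) : ℂ)) (e.symm p : ℂ)) ∘ h.param) := hmem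
  have hzero := hext.eq_zero (s := t + b) (by rwa [hst]) (by
    have hcont : Continuous fun x => dist (e.symm (h.param x) : ℂ) ζ :=
      (continuous_subtype_val.comp (e.symm.continuous.comp h.continuous_param)).dist
        continuous_const
    have hlt : dist (ξ : ℂ) ζ / 2 < dist (e.symm (h.param (t + b)) : ℂ) ζ := by
      rw [← hξ]; linarith
    filter_upwards [hcont.continuousAt.eventually (lt_mem_nhds hlt)] with x hx
    have : B (e.symm (h.param x) : ℂ) = 0 := B.zero_of_le_dist hx.le
    simp [this])
  have h1 : B (e.symm (h.param t) : ℂ) = 1 := B.one_of_mem_closedBall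
    (mem_closedBall_self (by positivity))
  simp [h1, hc] at hzero

end IsCollar

/-! ### The topology of `C^k` of the curve -/

theorem Ck.continuous_toFun {φ : ℂ → ℂ} {k : ℕ∞} (u : Ck φ k) : Continuous u.toFun :=
  (Subtype.prop u).1

instance (k : ℕ∞) : Nonempty {l : ℕ // (l : ℕ∞) ≤ k} := ⟨⟨0, by simp⟩⟩

theorem withSeminorms_ckSeminorm (φ : ℂ → ℂ) (k : ℕ∞) : WithSeminorms (ckSeminorm φ k) := ⟨rfl⟩

/-- The seminorm of order `0` is the sup norm, so the topology of `C^k` is at least as fine as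
uniform convergence. -/
theorem Ck.exists_approx_of_mem_closure {φ : ℂ → ℂ} {k : ℕ∞} {T : Set (Ck φ k)} {u : Ck φ k}
    (hu : u ∈ closure T) {ε : ℝ} (hε : 0 < ε) :
    ∃ u' ∈ T, ∀ z, ‖u.toFun z - u'.toFun z‖ ≤ ε := by
  set l₀ : {l : ℕ // (l : ℕ∞) ≤ k} := ⟨0, by simp⟩
  have hnb : (ckSeminorm φ k l₀).ball u ε ∈ 𝓝 u :=
    ((withSeminorms_ckSeminorm φ k).mem_nhds_iff u _).2
      ⟨{l₀}, ε, hε, by rw [Finset.sup_singleton]⟩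
  obtain ⟨u', hu'b, hu'T⟩ := mem_closure_iff_nhds.1 hu _ hnb
  refine ⟨u', hu'T, ?_⟩
  rintro ⟨_, θ, rfl⟩
  rw [Seminorm.mem_ball] at hu'b
  have h1 := le_ciSup ((u' - u).bddAbove l₀.2) θ
  have h2 : ‖(u' - u).toFun ⟨boundaryCurve φ θ, mem_range_self θ⟩‖ ≤ ε := by
    refine le_trans ?_ hu'b.le
    rw [iteratedDeriv_zero] at h1
    exact h1
  rw [norm_sub_rev]
  exact h2

/-- The bounded classes need not be closed, but their closures still consist of extendable
functions, so the closures have the same union. -/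
theorem Ck.isGδ_not_extends {φ : ℂ → ℂ} {k : ℕ∞} {S : Set ℂ} {Ψ : ℂ → ℂ} {r R : ℝ}
    (h : IsCollar (trace φ) S Ψ r R) :
    IsGδ {u : Ck φ k | ¬ ∃ z₀ ∈ trace φ, ExtendsAt (trace φ) S u.toFun z₀} := by
  have heq : {u : Ck φ k | ¬ ∃ z₀ ∈ trace φ, ExtendsAt (trace φ) S u.toFun z₀} =
      ⋂ i, (closure {u : Ck φ k | u.toFun ∈ h.bddClass i})ᶜ := by
    ext u
    rw [mem_iInter]
    constructor
    · intro hu i hi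
      refine hu (h.extendsAt_of_mem_halfDiscSubmodule u.continuous_toFun (div_pos
        Nat.one_div_pos_of_nat (by norm_num : (0 : ℝ) < 10)) (h.mem_halfDiscSubmodule_of_approx
          (i := i) fun ε hε => ?_))
      obtain ⟨u', h1, h2⟩ := Ck.exists_approx_of_mem_closure hi hε
      exact ⟨_, h1, h2⟩
    · rintro hu ⟨z₀, hz₀, hext⟩
      obtain ⟨i, hi⟩ := h.exists_mem_bddClass hz₀ hext
      exact hu i (subset_closure hi)
  rw [heq]
  exact IsGδ.iInter fun i => isClosed_closure.isOpen_compl.isGδ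

/-- The witness is a smooth function `H` on the plane transported by `e`; its pullback is `H
(e^{iθ})`, smooth for every `k`. Indexing the sides by `J` treats both at once. -/
theorem Ck.exists_not_extends {φ : ℂ → ℂ} (k : ℕ∞) (e : sphere (0 : ℂ) 1 ≃ₜ trace φ)
    (he : ∀ θ : ℝ, e ⟨_, exp_ofReal_mul_I_mem_sphere θ⟩ = ⟨boundaryCurve φ θ, mem_range_self θ⟩)
    {J : Type*} [Countable J] [Nonempty J] {S : J → Set ℂ} {Ψ : J → ℂ → ℂ} {r R : J → ℝ}
    (h : ∀ j, IsCollar (trace φ) (S j) (Ψ j) (r j) (R j)) :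
    ∃ w : Ck φ k, ∀ j, ¬ ∃ z₀ ∈ trace φ, ExtendsAt (trace φ) (S j) w.toFun z₀ := by
  have hpos : ∀ i : J × ℚ × ℕ × ℕ, (0 : ℝ) < 1 / ((i.2.2.1 : ℝ) + 1) / 10 := fun i =>
    div_pos Nat.one_div_pos_of_nat (by norm_num)
  choose g hg hgs hgQ using fun i : J × ℚ × ℕ × ℕ => (h i.1).exists_bump e i.2.1 (hpos i)
  obtain ⟨s, hs⟩ := exists_surjective_nat (J × ℚ × ℕ × ℕ)
  choose c hc hcb using fun n => exists_small_multiple (hg (s n)) (hgs (s n)) n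
  obtain ⟨x, hx⟩ := exists_tsum_notMem
    (fun n (p : trace φ) => (c n • g (s n)) (e.symm p : ℂ))
    (fun n p => by simpa using hcb n 0 (Nat.zero_le n) (e.symm p : ℂ))
    (fun i : J × ℚ × ℕ × ℕ => (h i.1).bddClass i.2)
    (fun i => halfDiscSubmodule (h i.1).param i.2.1 (1 / ((i.2.2.1 : ℝ) + 1) / 10))
    (fun i u hu => (h i.1).mem_halfDiscSubmodule_of_approx hu)
    (fun i => by
      obtain ⟨n, rfl⟩ := hs i
      exact ⟨n, hgQ (s n) (c n) (hc n).ne'⟩)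
  set H : ℂ → ℂ := fun z => ∑' n, x n * (c n • g (s n)) z with hH
  have hHs : ContDiff ℝ ∞ H := contDiff_tsum_coeff (fun n => (hg (s n)).const_smul (c n)) hcb
    (fun n => x.norm_coe_le_norm n)
  have hpull : pullback φ (fun p => H (e.symm p)) =
      fun θ : ℝ => H (Complex.exp (θ * Complex.I)) := by
    funext θ
    simp only [pullback]
    rw [← he θ, e.symm_apply_apply]
  refine ⟨⟨fun p => H (e.symm p), ?_, ?_⟩, ?_⟩
  · exact hHs.continuous.comp (continuous_subtype_val.comp e.symm.continuous)
  · rw [hpull]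
    have hexp : ContDiff ℝ ∞ fun θ : ℝ => Complex.exp (θ * Complex.I) :=
      (Complex.ofRealCLM.contDiff.mul contDiff_const).cexp
    exact (hHs.comp hexp).of_le (by exact_mod_cast le_top)
  · rintro j ⟨z₀, hz₀, hext⟩
    obtain ⟨i, hi⟩ := (h j).exists_mem_bddClass hz₀ hext
    exact hx (j, i) hi

/-- On each real line `u + c w` only countably many `c` are bad, so good ones exist arbitrarily near
`0`. Completeness of `C^k` plays no role. -/
theorem Ck.dense_not_extends {φ : ℂ → ℂ} {k : ℕ∞} {J : Type*} [Countable J] {S : J → Set ℂ}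
    {Ψ : J → ℂ → ℂ} {r R : J → ℝ} (h : ∀ j, IsCollar (trace φ) (S j) (Ψ j) (r j) (R j))
    (w : Ck φ k) (hw : ∀ j, ¬ ∃ z₀ ∈ trace φ, ExtendsAt (trace φ) (S j) w.toFun z₀) :
    Dense {u : Ck φ k | ∀ j, ¬ ∃ z₀ ∈ trace φ, ExtendsAt (trace φ) (S j) u.toFun z₀} := by
  have hts := (withSeminorms_ckSeminorm φ k)
  have : ContinuousSMul ℂ (Ck φ k) := hts.continuousSMul
  have : IsTopologicalAddGroup (Ck φ k) := hts.topologicalAddGroup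
  -- Two parameters in one class would make `(c - d) • w`, hence `w`, extend over that half disc.
  have hsub : ∀ u : Ck φ k, ∀ j i,
      {c : ℝ | (u + (c : ℂ) • w).toFun ∈ (h j).bddClass i}.Subsingleton := by
    intro u j i c hc d hd
    by_contra hne
    have hpos : (0 : ℝ) < 1 / ((i.2.1 : ℝ) + 1) := Nat.one_div_pos_of_nat
    have hc' : (u + (c : ℂ) • w).toFun ∈
      halfDiscSubmodule (h j).param i.1 (1 / ((i.2.1 : ℝ) + 1)) := hc.halfDiscExt
    have hd' : (u + (d : ℂ) • w).toFun ∈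
      halfDiscSubmodule (h j).param i.1 (1 / ((i.2.1 : ℝ) + 1)) := hd.halfDiscExt
    have hcd := Submodule.sub_mem _ hc' hd'
    have heq : (u + (c : ℂ) • w).toFun - (u + (d : ℂ) • w).toFun = ((c : ℂ) - d) • w.toFun := by
      rw [Ck.toFun_add, Ck.toFun_add, Ck.toFun_smul, Ck.toFun_smul, sub_smul]
      abel
    rw [heq, Submodule.smul_mem_iff _ (sub_ne_zero.2 fun h' => hne (Complex.ofReal_injective h'))]
      at hcd
    exact hw j ((h j).extendsAt_of_mem_halfDiscSubmodule w.continuous_toFun hpos hcd)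
  intro u
  rw [mem_closure_iff_nhds]
  intro V hV
  have hcont : Continuous fun c : ℝ => u + (c : ℂ) • w :=
    continuous_const.add (Complex.continuous_ofReal.smul continuous_const)
  have hcount : (⋃ j, ⋃ i, {c : ℝ | (u + (c : ℂ) • w).toFun ∈ (h j).bddClass i}).Countable :=
    countable_iUnion fun j => countable_iUnion fun i => (hsub u j i).finite.countable
  have hV' : (fun c : ℝ => u + (c : ℂ) • w) ⁻¹' V ∈ 𝓝 (0 : ℝ) := by
    refine hcont.continuousAt.preimage_mem_nhds ?_
    simpa using hV
  obtain ⟨c, hcV, hc⟩ := mem_closure_iff_nhds.1 ((hcount.dense_compl ℝ) 0) _ hV'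
  refine ⟨u + (c : ℂ) • w, hcV, fun j => ?_⟩
  rintro ⟨z₀, hz₀, hext⟩
  obtain ⟨i, hi⟩ := (h j).exists_mem_bddClass hz₀ hext
  exact hc (mem_iUnion.2 ⟨j, mem_iUnion.2 ⟨i, hi⟩⟩)

/-! ### Assembling the theorem from the analytic curve and the Riemann map. -/

theorem exists_collars_and_homeomorph {δ : ℝ → ℂ} (hδ : IsAnalytic δ) {φ : ℂ → ℂ}
    (hφ : IsRiemannMap φ (boundedSide (range δ))) :
    (∃ Ψ r R, IsCollar (trace φ) (boundedSide (trace φ)) Ψ r R) ∧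
      (∃ Ψ r R, IsCollar (trace φ) (unboundedSide (trace φ)) Ψ r R) ∧
      ∃ e : sphere (0 : ℂ) 1 ≃ₜ trace φ, ∀ θ : ℝ,
        e ⟨_, exp_ofReal_mul_I_mem_sphere θ⟩ = ⟨boundaryCurve φ θ, mem_range_self θ⟩ := by
  obtain ⟨r, R, Φ, hr, hr1, hR, hd, hi, hδΦ⟩ := hδ
  have hK : Φ '' sphere 0 1 = range δ := by
    ext p
    constructor
    · rintro ⟨ζ, hζ, rfl⟩
      obtain ⟨θ, rfl⟩ := exists_exp_ofReal_mul_I_eq hζ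
      exact ⟨θ, hδΦ θ⟩
    · rintro ⟨θ, rfl⟩
      exact ⟨_, exp_ofReal_mul_I_mem_sphere θ, (hδΦ θ).symm⟩
  obtain ⟨⟨Ψ, r', R', hb⟩, hu⟩ := exists_isCollar hr hr1 hR hd hi hK
    -- The existence of the Riemann map supplies a point of the bounded side.
    ⟨φ 0, hφ.2.mapsTo (mem_ball_self one_pos)⟩
  obtain ⟨htr, he⟩ := exists_boundary_homeomorph hb hφ
  rw [htr.symm] at hb hu
  exact ⟨⟨Ψ, r', R', hb⟩, hu, he⟩

end JordanCurve

theorem theorem4p27 (δ : ℝ → ℂ) (hδ : JordanCurve.IsAnalytic δ) (φ : ℂ → ℂ)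
    (hφ : JordanCurve.IsRiemannMap φ (JordanCurve.boundedSide (Set.range δ))) (k : ℕ∞) :
    (Dense (JordanCurve.U₂ φ k) ∧ IsGδ (JordanCurve.U₂ φ k)) ∧
    (Dense (JordanCurve.U₃ φ k) ∧ IsGδ (JordanCurve.U₃ φ k)) ∧
    (Dense (JordanCurve.U₄ φ k) ∧ IsGδ (JordanCurve.U₄ φ k)) := by
  open JordanCurve in
  obtain ⟨⟨Ψ₁, r₁, R₁, h₁⟩, ⟨Ψ₂, r₂, R₂, h₂⟩, e, he⟩ := exists_collars_and_homeomorph hδ hφ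
  -- Handling both sides together gives density of `U₄`, and `U₂`, `U₃` contain it.
  let S : Bool → Set ℂ := fun j => bif j then unboundedSide (trace φ) else boundedSide (trace φ)
  have h : ∀ j, IsCollar (trace φ) (S j) (bif j then Ψ₂ else Ψ₁) (bif j then r₂ else r₁)
      (bif j then R₂ else R₁) := fun j => by
    cases j
    · exact h₁
    · exact h₂
  obtain ⟨w, hw⟩ := Ck.exists_not_extends k e he h
  have hall := Ck.dense_not_extends h w hw
  have hdense : Dense (U₄ φ k) := hall.mono
    fun u (hu : ∀ j, ¬ ∃ z₀ ∈ trace φ, ExtendsAt (trace φ) (S j) u.toFun z₀) =>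
      ⟨hu true, hu false⟩
  exact ⟨⟨hdense.mono fun u hu => hu.1, Ck.isGδ_not_extends h₂⟩,
    ⟨hdense.mono fun u hu => hu.2, Ck.isGδ_not_extends h₁⟩,
    hdense, (Ck.isGδ_not_extends h₂).inter (Ck.isGδ_not_extends h₁)⟩
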